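/- Let $k$ be a commutative base ring (for instance a field). Algebras are associative unital $k$-algebras, and $(A,B)$-bimodules are $k$-central. Let $B_1,B_2$ be two-sided noetherian $k$-algebras and $d\in\mathbb N$. **Dimension function.** Let $\partial$ assign to every left or right module over $B_1$ or $B_2$ a value in $\mathbb R_{\ge 0}\cup\{\pm\infty\}$, invariant under isomorphism, and on each of these four module categories be an exact dimension function: $\partial(M)=-\infty$ iff $M=0$; $\partial(M)=\max\{\partial(N),\partial(M/N)\}$ for every submodule $N\subseteq M$; and $\partial(\bigcup_i M_i)=\sup_i\partial(M_i)$ for every (nonempty) directed family of submodules. Suppose further that for $(A,B)=(B_1,B_2)$ and $(A,B)=(B_2,B_1)$ the following two conditions hold. 1. For every $(A,B)$-bimodule $M$: if $M_B$ is finitely generated then $\partial({}_AM)\le\partial(M_B)$, and if ${}_AM$ is finitely generated then $\partial(M_B)\le\partial({}_AM)$. 2. ($\gamma_{d-2,1}(A,B)$) For every $(A,B)$-bimodule $M$ finitely generated on both sides and $j\in\{0,1\}$: if $N$ is a finitely generated right $A$-module with $\partial(N)\le d-2$, then $\operatorname{Tor}^A_j(N,M)$ is a finitely generated right $B$-module with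 $\partial\le d-2$; and if $N$ is a finitely generated left $B$-module with $\partial(N)\le d-2$, then $\operatorname{Tor}^B_j(M,N)$ is a finitely generated left $A$-module with $\partial\le d-2$. **Algebras.** For a left or right $A$-module $M$ let $j(M)=\inf\{i:\operatorname{Ext}^i_A(M,A)\ne0\}\in\mathbb N\cup\{\infty\}$. The algebra $A$ is *Auslander–Gorenstein* if $\operatorname{injdim}A_A=\operatorname{injdim}{}_AA<\infty$ and, for every finitely generated left or right $A$-module $M$ and every $q\ge 0$, every $A$-submodule $N$ of $\operatorname{Ext}^q_A(M,A)$ satisfies $j(N)\ge q$. It is *$\partial$-CM of dimension $d$* if $\partial({}_AA)=\partial(A_A)=d$ and $j(M)+\partial(M)=d$ for every nonzero finitely generated left or right $A$-module $M$. Suppose that $B_1$ and $B_2$ are Auslander–Gorenstein and $\partial$-CM of dimension $d$. **$n$-isomorphism.** For $n\in\mathbb Z$, two $(D,A)$-bimodules $X,Y$ are *$n$-isomorphic*, $X\cong_nY$, if there are a $(D,A)$-bimodule $P$ and bimodule maps $X\to P$ and $Y\to P$ whose kernels and cokernels, as right $A$-modules, have $\partial\le n$. **Proposition 3.9.** Suppose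 that there are bimodules ${}_{B_1}T_{B_2}$ and ${}_{B_2}\widetilde T_{B_1}$, finitely generated on both sides, such that $$T\otimes_{B_2}\widetilde T\cong_{d-2}B_1\quad\text{and}\quad \widetilde T\otimes_{B_1}T\cong_{d-2}B_2$$ as bimodules. Then there are bimodules ${}_{B_1}U_{B_2}$ and ${}_{B_2}V_{B_1}$, finitely generated on both sides, each reflexive as a left module and as a right module (that is, the natural map from the module to its double dual over the algebra acting on that side is an isomorphism), such that $$U\otimes_{B_2}V\cong_{d-2}B_1\quad\text{and}\quad V\otimes_{B_1}U\cong_{d-2}B_2$$ as bimodules. -/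

import Mathlib

open CategoryTheory
open scoped TensorProduct

universe v u

noncomputable section

/-! Conventions: a right module over `A` is a module over `Aᵐᵒᵖ`, a left module over `A` is a module
over `A`.  The ring `A` itself is a left module over `A` and (by right multiplication) a module
over `Aᵐᵒᵖ`. -/

/-! ### Dimension functions -/

/-- A function assigning a value in the extended reals to every module over every ring; the left
`A`-modules are evaluated at the ring `A`, the right `A`-modules at the ring `Aᵐᵒᵖ`. -/
abbrev DimFunction : Type (u + 1) :=
  ∀ (R : Type u) [Ring R] (M : Type u) [AddCommGroup M] [Module R M], EReal

/-- `δ` restricts to a dimension function on the modules over `R`. -/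
structure DimFunction.IsDimension (δ : DimFunction.{u}) (R : Type u) [Ring R] : Prop where
  /-- The values lie in `ℝ≥0 ∪ {-∞, +∞}`. -/
  bot_or_nonneg : ∀ (M : Type u) [AddCommGroup M] [Module R M], δ R M = ⊥ ∨ 0 ≤ δ R M
  /-- Isomorphic modules have the same dimension. -/
  congr : ∀ (M N : Type u) [AddCommGroup M] [AddCommGroup N] [Module R M] [Module R N],
    (M ≃ₗ[R] N) → δ R M = δ R N
  eq_bot_iff : ∀ (M : Type u) [AddCommGroup M] [Module R M], δ R M = ⊥ ↔ Subsingleton M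
  max_le : ∀ (M : Type u) [AddCommGroup M] [Module R M] (N : Submodule R M),
    max (δ R N) (δ R (M ⧸ N)) ≤ δ R M

/-- `δ` restricts to an exact dimension function on the modules over `R`. -/
structure DimFunction.IsExact (δ : DimFunction.{u}) (R : Type u) [Ring R] : Prop
    extends δ.IsDimension R where
  eq_max : ∀ (M : Type u) [AddCommGroup M] [Module R M] (N : Submodule R M),
    δ R M = max (δ R N) (δ R (M ⧸ N))
  /-- Compatibility with directed unions of submodules (`sSup` of a directed family of submodules
  is its union). -/
  sSup_directed : ∀ (M : Type u) [AddCommGroup M] [Module R M] (F : Set (Submodule R M)),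
    F.Nonempty → DirectedOn (· ≤ ·) F → δ R (sSup F : Submodule R M) = ⨆ N ∈ F, δ R N

/-! ### Bimodules -/

/-- `(A, B)`-bimodules over the base ring `k`: left `A`-modules and right `B`-modules with
commuting actions, on which both actions restrict to the same action of `k`.
No finiteness is required. -/
structure AlgBimodule (k : Type v) [CommRing k] (A B : Type u) [Ring A] [Algebra k A]
    [Ring B] [Algebra k B] where
  carrier : Type u
  [addCommGroup : AddCommGroup carrier]
  [leftModule : Module A carrier]
  [rightModule : Module Bᵐᵒᵖ carrier]
  [smulCommClass : SMulCommClass A Bᵐᵒᵖ carrier]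
  central : ∀ (c : k) (m : carrier),
    algebraMap k A c • m = MulOpposite.op (algebraMap k B c) • m

namespace AlgBimodule

variable {k : Type v} [CommRing k] {A B C : Type u} [Ring A] [Algebra k A] [Ring B] [Algebra k B]
  [Ring C] [Algebra k C]

instance : CoeSort (AlgBimodule k A B) (Type u) := ⟨AlgBimodule.carrier⟩

attribute [instance] AlgBimodule.addCommGroup AlgBimodule.leftModule AlgBimodule.rightModule
  AlgBimodule.smulCommClass

/-- The bimodule is finitely generated on both sides. -/
def IsFG (M : AlgBimodule k A B) : Prop := Module.Finite A M ∧ Module.Finite Bᵐᵒᵖ M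

variable (k A) in
/-- The algebra `A` as a bimodule over itself. -/
def regular : AlgBimodule k A A where
  carrier := A
  central c m := by
    simp only [smul_eq_mul, MulOpposite.smul_eq_mul_unop, MulOpposite.unop_op]
    exact Algebra.commutes c m

/-- Morphisms of bimodules: right linear maps that are also left linear. -/
structure Hom (X Y : AlgBimodule k A B) extends X →ₗ[Bᵐᵒᵖ] Y where
  map_left_smul : ∀ (a : A) (x : X), toFun (a • x) = a • toFun x

/-- The kernel and the cokernel of a bimodule morphism, viewed as right modules, have dimension at
most `n`. -/
def Hom.IsNIso (δ : DimFunction.{u}) (n : ℤ) {X Y : AlgBimodule k A B} (f : Hom X Y) : Prop :=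
  δ Bᵐᵒᵖ (LinearMap.ker f.toLinearMap) ≤ ((n : ℝ) : EReal) ∧
    δ Bᵐᵒᵖ (Y ⧸ LinearMap.range f.toLinearMap) ≤ ((n : ℝ) : EReal)

/-- The bimodules `X` and `Y` are `n`-isomorphic. -/
def NIsomorphic (δ : DimFunction.{u}) (n : ℤ) (X Y : AlgBimodule k A B) : Prop :=
  ∃ (P : AlgBimodule k A B) (f : Hom X P) (g : Hom Y P), f.IsNIso δ n ∧ g.IsNIso δ n

end AlgBimodule

/-! ### Tensor products over noncommutative rings -/

section Tensor

/-- The subgroup generated by the relations `m r ⊗ n = m ⊗ r n`. -/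
def NCTensor.relations (R M N : Type u) [Ring R] [AddCommGroup M] [Module Rᵐᵒᵖ M]
    [AddCommGroup N] [Module R N] : AddSubgroup (M ⊗[ℤ] N) :=
  AddSubgroup.closure {x | ∃ (m : M) (r : R) (n : N),
    x = (MulOpposite.op r • m) ⊗ₜ[ℤ] n - m ⊗ₜ[ℤ] (r • n)}

/-- The tensor product over `R` of a right `R`-module `M` and a left `R`-module `N`. -/
def NCTensor (R M N : Type u) [Ring R] [AddCommGroup M] [Module Rᵐᵒᵖ M]
    [AddCommGroup N] [Module R N] : Type u :=
  (M ⊗[ℤ] N) ⧸ NCTensor.relations R M N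

namespace NCTensor

variable {R M M' M'' N N' N'' : Type u} [Ring R]
  [AddCommGroup M] [Module Rᵐᵒᵖ M] [AddCommGroup M'] [Module Rᵐᵒᵖ M']
  [AddCommGroup M''] [Module Rᵐᵒᵖ M'']
  [AddCommGroup N] [Module R N] [AddCommGroup N'] [Module R N'] [AddCommGroup N''] [Module R N'']

instance : AddCommGroup (NCTensor R M N) :=
  inferInstanceAs (AddCommGroup ((M ⊗[ℤ] N) ⧸ NCTensor.relations R M N))

variable (R M N) in
/-- The projection from the tensor product over `ℤ`. -/
def mk : M ⊗[ℤ] N →+ NCTensor R M N := QuotientAddGroup.mk' (NCTensor.relations R M N)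

variable (R) in
/-- The pure tensor `m ⊗ n`. -/
def tmul (m : M) (n : N) : NCTensor R M N := mk R M N (m ⊗ₜ[ℤ] n)

theorem tmul_add (m : M) (n n' : N) : tmul R m (n + n') = tmul R m n + tmul R m n' := by
  simp only [tmul, TensorProduct.tmul_add, map_add]

theorem add_tmul (m m' : M) (n : N) : tmul R (m + m') n = tmul R m n + tmul R m' n := by
  simp only [tmul, TensorProduct.add_tmul, map_add]

theorem smul_tmul (r : R) (m : M) (n : N) :
    tmul R (MulOpposite.op r • m) n = tmul R m (r • n) := by
  rw [← sub_eq_zero]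
  simp only [tmul, ← map_sub]
  exact (QuotientAddGroup.eq_zero_iff _).2 (AddSubgroup.subset_closure ⟨m, r, n, rfl⟩)

theorem addHom_ext {G : Type*} [AddCommGroup G] {φ ψ : NCTensor R M N →+ G}
    (h : ∀ m n, φ (tmul R m n) = ψ (tmul R m n)) : φ = ψ := by
  have key : φ.comp (mk R M N) = ψ.comp (mk R M N) := by
    refine AddMonoidHom.ext fun z => ?_
    induction z using TensorProduct.induction_on with
    | zero => simp only [map_zero]
    | tmul m n => exact h m n
    | add x y hx hy => simp only [map_add, hx, hy]
  ext x
  obtain ⟨x, rfl⟩ := QuotientAddGroup.mk'_surjective _ x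
  exact DFunLike.congr_fun key x

/-- The tensor product of two linear maps, as an additive map. -/
def map (f : M →ₗ[Rᵐᵒᵖ] M') (g : N →ₗ[R] N') : NCTensor R M N →+ NCTensor R M' N' :=
  QuotientAddGroup.lift (NCTensor.relations R M N)
    ((mk R M' N').comp (TensorProduct.map f.toAddMonoidHom.toIntLinearMap
      g.toAddMonoidHom.toIntLinearMap).toAddMonoidHom) (by
      rw [NCTensor.relations, AddSubgroup.closure_le]
      rintro _ ⟨m, r, n, rfl⟩
      have e := smul_tmul r (f m) (g n)
      rw [← map_smul, ← map_smul] at e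
      rw [SetLike.mem_coe, AddMonoidHom.mem_ker, map_sub]
      exact sub_eq_zero.2 e)

@[simp]
theorem map_tmul (f : M →ₗ[Rᵐᵒᵖ] M') (g : N →ₗ[R] N') (m : M) (n : N) :
    map f g (tmul R m n) = tmul R (f m) (g n) := rfl

theorem map_id : map (LinearMap.id : M →ₗ[Rᵐᵒᵖ] M) (LinearMap.id : N →ₗ[R] N) =
    AddMonoidHom.id _ :=
  addHom_ext fun _ _ => rfl

theorem map_comp (f : M →ₗ[Rᵐᵒᵖ] M') (f' : M' →ₗ[Rᵐᵒᵖ] M'') (g : N →ₗ[R] N')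
    (g' : N' →ₗ[R] N'') : map (f' ∘ₗ f) (g' ∘ₗ g) = (map f' g').comp (map f g) :=
  addHom_ext fun _ _ => rfl

theorem map_add_left (f f' : M →ₗ[Rᵐᵒᵖ] M') (g : N →ₗ[R] N') :
    map (f + f') g = map f g + map f' g :=
  addHom_ext fun m n => by simp [add_tmul]

theorem map_add_right (f : M →ₗ[Rᵐᵒᵖ] M') (g g' : N →ₗ[R] N') :
    map f (g + g') = map f g + map f g' :=
  addHom_ext fun m n => by simp [tmul_add]

theorem map_zero_left (g : N →ₗ[R] N') : map (0 : M →ₗ[Rᵐᵒᵖ] M') g = 0 := by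
  simpa using map_add_left (0 : M →ₗ[Rᵐᵒᵖ] M') 0 g

theorem map_zero_right (f : M →ₗ[Rᵐᵒᵖ] M') : map f (0 : N →ₗ[R] N') = 0 := by
  simpa using map_add_right f (0 : N →ₗ[R] N') 0

/-- The action `s (m ⊗ n) = (s m) ⊗ n` coming from an action on the left factor. -/
abbrev leftAction (S : Type u) [Ring S] [Module S M] [SMulCommClass S Rᵐᵒᵖ M] :
    Module S (NCTensor R M N) where
  smul s x := map (DistribSMul.toLinearMap Rᵐᵒᵖ M s) LinearMap.id x
  one_smul x := by
    refine (DFunLike.congr_fun (?_ : map _ _ = AddMonoidHom.id _) x)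
    exact addHom_ext fun m n => by simp
  mul_smul s t x := by
    refine (DFunLike.congr_fun (?_ : map _ _ = (map _ _).comp (map _ _)) x)
    exact addHom_ext fun m n => by simp [mul_smul]
  smul_zero s := map_zero (map _ _)
  smul_add s := map_add (map _ _)
  add_smul s t x := by
    refine (DFunLike.congr_fun (?_ : map _ _ = map _ _ + map _ _) x)
    exact addHom_ext fun m n => by simp [add_smul, add_tmul]
  zero_smul x := by
    refine (DFunLike.congr_fun (?_ : map _ _ = 0) x)
    exact addHom_ext fun m n => by simpa using add_tmul (R := R) (0 : M) 0 n

/-- The action `s (m ⊗ n) = m ⊗ (s n)` coming from an action on the right factor. -/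
abbrev rightAction (S : Type u) [Ring S] [Module S N] [SMulCommClass S R N] :
    Module S (NCTensor R M N) where
  smul s x := map LinearMap.id (DistribSMul.toLinearMap R N s) x
  one_smul x := by
    refine (DFunLike.congr_fun (?_ : map _ _ = AddMonoidHom.id _) x)
    exact addHom_ext fun m n => by simp
  mul_smul s t x := by
    refine (DFunLike.congr_fun (?_ : map _ _ = (map _ _).comp (map _ _)) x)
    exact addHom_ext fun m n => by simp [mul_smul]
  smul_zero s := map_zero (map _ _)
  smul_add s := map_add (map _ _)
  add_smul s t x := by
    refine (DFunLike.congr_fun (?_ : map _ _ = map _ _ + map _ _) x)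
    exact addHom_ext fun m n => by simp [add_smul, tmul_add]
  zero_smul x := by
    refine (DFunLike.congr_fun (?_ : map _ _ = 0) x)
    exact addHom_ext fun m n => by simpa using tmul_add (R := R) m (0 : N) 0

end NCTensor

end Tensor

namespace AlgBimodule

variable {k : Type v} [CommRing k] {A B C : Type u} [Ring A] [Algebra k A] [Ring B] [Algebra k B]
  [Ring C] [Algebra k C]

instance (M : AlgBimodule k A B) : SMulCommClass Bᵐᵒᵖ A M := SMulCommClass.symm _ _ _

/-- The `(A, C)`-bimodule `X ⊗_B Y`. -/
def tensor (X : AlgBimodule k A B) (Y : AlgBimodule k B C) : AlgBimodule k A C where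
  carrier := NCTensor B X Y
  leftModule := NCTensor.leftAction A
  rightModule := NCTensor.rightAction Cᵐᵒᵖ
  smulCommClass := by
    let : Module A (NCTensor B X Y) := NCTensor.leftAction A
    let : Module Cᵐᵒᵖ (NCTensor B X Y) := NCTensor.rightAction Cᵐᵒᵖ
    refine ⟨fun a c x => ?_⟩
    refine (DFunLike.congr_fun
      (?_ : (NCTensor.map _ _).comp (NCTensor.map _ _) =
        (NCTensor.map _ _).comp (NCTensor.map _ _)) x)
    exact NCTensor.addHom_ext fun m n => by simp
  central c x := by
    refine (DFunLike.congr_fun (?_ : NCTensor.map _ _ = NCTensor.map _ _) x)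
    exact NCTensor.addHom_ext fun m n => by
      simp [X.central, ← Y.central, NCTensor.smul_tmul]

/-- The right `B`-module `N ⊗_A M`, for a right `A`-module `N`. -/
def tensorRightObj (M : AlgBimodule k A B) (N : ModuleCat.{u} Aᵐᵒᵖ) : ModuleCat.{u} Bᵐᵒᵖ :=
  @ModuleCat.of Bᵐᵒᵖ _ (NCTensor A N M) _ (NCTensor.rightAction Bᵐᵒᵖ)

/-- The left `A`-module `M ⊗_B N`, for a left `B`-module `N`. -/
def tensorLeftObj (M : AlgBimodule k A B) (N : ModuleCat.{u} B) : ModuleCat.{u} A :=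
  @ModuleCat.of A _ (NCTensor B M N) _ (NCTensor.leftAction A)

/-- The functor `N ↦ N ⊗_A M` from right `A`-modules to right `B`-modules. -/
def tensorRightFunctor (M : AlgBimodule k A B) :
    ModuleCat.{u} Aᵐᵒᵖ ⥤ ModuleCat.{u} Bᵐᵒᵖ where
  obj N := M.tensorRightObj N
  map {N N'} f := @ModuleCat.ofHom Bᵐᵒᵖ _ (M.tensorRightObj N) (M.tensorRightObj N') _ _ _ _
    { toFun := NCTensor.map f.hom LinearMap.id
      map_add' := map_add (NCTensor.map f.hom LinearMap.id)
      map_smul' := fun b x => by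
        refine (DFunLike.congr_fun
          (?_ : (NCTensor.map _ _).comp (NCTensor.map _ _) =
            (NCTensor.map _ _).comp (NCTensor.map _ _)) x)
        exact NCTensor.addHom_ext fun m n => by simp }
  map_id N := by
    apply ModuleCat.hom_ext
    apply LinearMap.ext
    intro x
    exact DFunLike.congr_fun NCTensor.map_id x
  map_comp f g := by
    apply ModuleCat.hom_ext
    apply LinearMap.ext
    intro x
    exact DFunLike.congr_fun (NCTensor.map_comp f.hom g.hom LinearMap.id LinearMap.id) x

instance (M : AlgBimodule k A B) : M.tensorRightFunctor.Additive where
  map_add {N N' f g} := by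
    apply ModuleCat.hom_ext
    apply LinearMap.ext
    intro x
    exact DFunLike.congr_fun (NCTensor.map_add_left f.hom g.hom LinearMap.id) x

/-- The functor `N ↦ M ⊗_B N` from left `B`-modules to left `A`-modules. -/
def tensorLeftFunctor (M : AlgBimodule k A B) : ModuleCat.{u} B ⥤ ModuleCat.{u} A where
  obj N := M.tensorLeftObj N
  map {N N'} f := @ModuleCat.ofHom A _ (M.tensorLeftObj N) (M.tensorLeftObj N') _ _ _ _
    { toFun := NCTensor.map LinearMap.id f.hom
      map_add' := map_add (NCTensor.map LinearMap.id f.hom)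
      map_smul' := fun b x => by
        refine (DFunLike.congr_fun
          (?_ : (NCTensor.map _ _).comp (NCTensor.map _ _) =
            (NCTensor.map _ _).comp (NCTensor.map _ _)) x)
        exact NCTensor.addHom_ext fun m n => by simp }
  map_id N := by
    apply ModuleCat.hom_ext
    apply LinearMap.ext
    intro x
    exact DFunLike.congr_fun NCTensor.map_id x
  map_comp f g := by
    apply ModuleCat.hom_ext
    apply LinearMap.ext
    intro x
    exact DFunLike.congr_fun (NCTensor.map_comp LinearMap.id LinearMap.id f.hom g.hom) x

instance (M : AlgBimodule k A B) : M.tensorLeftFunctor.Additive where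
  map_add {N N' f g} := by
    apply ModuleCat.hom_ext
    apply LinearMap.ext
    intro x
    exact DFunLike.congr_fun (NCTensor.map_add_right LinearMap.id f.hom g.hom) x

/-- `Tor_j^A(N, M)` as a right `B`-module, for a right `A`-module `N`. -/
def torRight (M : AlgBimodule k A B) (j : ℕ) (N : ModuleCat.{u} Aᵐᵒᵖ) : ModuleCat.{u} Bᵐᵒᵖ :=
  (M.tensorRightFunctor.leftDerived j).obj N

/-- `Tor_j^B(M, N)` as a left `A`-module, for a left `B`-module `N`. -/
def torLeft (M : AlgBimodule k A B) (j : ℕ) (N : ModuleCat.{u} B) : ModuleCat.{u} A :=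
  (M.tensorLeftFunctor.leftDerived j).obj N

end AlgBimodule

/-! ### Standing hypotheses on the dimension function -/

namespace DimFunction

/-- `M` is a finitely generated `R`-module of dimension at most `n`. -/
def IsSmall (δ : DimFunction.{u}) (n : ℤ) (R : Type u) [Ring R] (M : ModuleCat.{u} R) : Prop :=
  Module.Finite R M ∧ δ R M ≤ ((n : ℝ) : EReal)

variable (k : Type v) [CommRing k] (A B : Type u) [Ring A] [Algebra k A] [Ring B] [Algebra k B]

/-- For `(A, B)`-bimodules that are finitely generated on one side, the dimension on the other side
is at most the dimension on that side. -/
def IsSymmetric (δ : DimFunction.{u}) : Prop :=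
  ∀ M : AlgBimodule k A B,
    (Module.Finite Bᵐᵒᵖ M → δ A M ≤ δ Bᵐᵒᵖ M) ∧ (Module.Finite A M → δ Bᵐᵒᵖ M ≤ δ A M)

/-- The condition `γ_{n,i}(A, B)`: for every `(A, B)`-bimodule `M` finitely generated on both
sides, `Tor_j(-, M)` and `Tor_j(M, -)`, `0 ≤ j ≤ i`, preserve finitely generated modules of
dimension at most `n`. -/
def SatisfiesGamma (δ : DimFunction.{u}) (n : ℤ) (i : ℕ) : Prop :=
  ∀ M : AlgBimodule k A B, M.IsFG →
    (∀ N : ModuleCat.{u} Aᵐᵒᵖ, δ.IsSmall n Aᵐᵒᵖ N →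
      ∀ j ≤ i, δ.IsSmall n Bᵐᵒᵖ (M.torRight j N)) ∧
    (∀ N : ModuleCat.{u} B, δ.IsSmall n B N →
      ∀ j ≤ i, δ.IsSmall n A (M.torLeft j N))

end DimFunction

/-! ### Homological conditions

In this part `D` carries commuting actions of `R` and `S`.  For an algebra `A` one takes `D = A`
with `(R, S) = (A, Aᵐᵒᵖ)` for left modules and `(R, S) = (Aᵐᵒᵖ, A)` for right modules. -/

section Homological

/-- `Ext^q_R(M, D)`. -/
def ExtMod (R D M : Type u) [Ring R] [AddCommGroup D] [Module R D] [AddCommGroup M] [Module R M]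
    (q : ℕ) : Type u :=
  Abelian.Ext.{u} (ModuleCat.of R M) (ModuleCat.of R D) q

variable (R S D M : Type u) [Ring R] [Ring S] [AddCommGroup D] [Module R D] [Module S D]
  [SMulCommClass S R D] [AddCommGroup M] [Module R M]

instance (q : ℕ) : AddCommGroup (ExtMod R D M q) :=
  inferInstanceAs (AddCommGroup (Abelian.Ext.{u} (ModuleCat.of R M) (ModuleCat.of R D) q))

/-- `Ext^q_R(M, D)` is an `S`-module through the functoriality of `Ext` in `D`. -/
instance (q : ℕ) : Module S (ExtMod R D M q) where
  smul s x := Abelian.Ext.comp (x : Abelian.Ext.{u} (ModuleCat.of R M) (ModuleCat.of R D) q)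
    (Abelian.Ext.mk₀ (ModuleCat.ofHom (DistribSMul.toLinearMap R D s))) (add_zero q)
  one_smul x := by
    refine Eq.trans ?_ (Abelian.Ext.comp_mk₀_id x)
    refine congrArg (fun f => Abelian.Ext.comp x (Abelian.Ext.mk₀ f) (add_zero q)) ?_
    ext y; simp
  mul_smul s t x := by
    refine Eq.trans ?_ (Abelian.Ext.comp_assoc x _ _ (add_zero q) (add_zero 0) (by simp)).symm
    refine congrArg (fun f => Abelian.Ext.comp x f (add_zero q)) ?_
    rw [Abelian.Ext.mk₀_comp_mk₀]
    congr 1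
    ext y; simp [mul_smul]
  smul_zero s := Abelian.Ext.zero_comp (X := ModuleCat.of R M) (Y := ModuleCat.of R D) q
    (Abelian.Ext.mk₀ (ModuleCat.ofHom (DistribSMul.toLinearMap R D s))) q (add_zero q)
  smul_add s x y := Abelian.Ext.add_comp _ _ _ _
  add_smul s t x := by
    refine Eq.trans ?_ (Abelian.Ext.comp_add x _ _ (add_zero q))
    refine congrArg (fun f => Abelian.Ext.comp x f (add_zero q)) ?_
    rw [← Abelian.Ext.mk₀_add]
    congr 1
    ext y; simp [add_smul]
  zero_smul x := by
    refine Eq.trans ?_ (Abelian.Ext.comp_zero x _ 0 q (add_zero q))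
    refine congrArg (fun f => Abelian.Ext.comp x f (add_zero q)) ?_
    rw [← Abelian.Ext.mk₀_zero]
    congr 1
    ext y; simp

/-- The grade number `inf {i | Ext^i_R(M, D) ≠ 0}`. -/
def gradeNumber (R D M : Type u) [Ring R] [AddCommGroup D] [Module R D] [AddCommGroup M]
    [Module R M] : ℕ∞ :=
  ⨅ (i : ℕ) (_ : Nontrivial (ExtMod R D M i)), (i : ℕ∞)

/-- The Auslander condition for the `R`-module `M`: every `S`-submodule of `Ext^q_R(M, D)` has
grade number at least `q`. -/
def AuslanderCondition : Prop :=
  ∀ (q : ℕ) (N : Submodule S (ExtMod R D M q)), (q : ℕ∞) ≤ gradeNumber S D N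

/-- The natural map from `M` to its double dual. -/
def toDoubleDual [SMulCommClass R S D] (m : M) : (M →ₗ[R] D) →ₗ[S] D where
  toFun φ := φ m
  map_add' _ _ := rfl
  map_smul' _ _ := rfl

/-- `M` is finitely generated and the natural map to its double dual is an isomorphism. -/
def IsReflexiveModule [SMulCommClass R S D] : Prop :=
  Module.Finite R M ∧ Function.Bijective (toDoubleDual R S D M)

end Homological

/-- Auslander-Gorenstein rings. -/
def IsAuslanderGorenstein (A : Type u) [Ring A] : Prop :=
  (∃ n : ℕ, injectiveDimension (ModuleCat.of A A) = n ∧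
    injectiveDimension (ModuleCat.of Aᵐᵒᵖ A) = n) ∧
  (∀ (M : Type u) [AddCommGroup M] [Module A M], Module.Finite A M →
    AuslanderCondition A Aᵐᵒᵖ A M) ∧
  (∀ (M : Type u) [AddCommGroup M] [Module Aᵐᵒᵖ M], Module.Finite Aᵐᵒᵖ M →
    AuslanderCondition Aᵐᵒᵖ A A M)

/-- `A` is Cohen-Macaulay with respect to `δ`, of dimension `d`: the left and the right module `A`
have dimension `d`, and grade number plus dimension is `d` for every nonzero finitely generated
left or right module. -/
def IsCohenMacaulayOfDim (δ : DimFunction.{u}) (A : Type u) [Ring A] (d : ℕ) : Prop :=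
  (δ A A = d ∧ δ Aᵐᵒᵖ A = d) ∧
  (∀ (M : Type u) [AddCommGroup M] [Module A M], Module.Finite A M → Nontrivial M →
    ((gradeNumber A A M : ENNReal) : EReal) + δ A M = d) ∧
  (∀ (M : Type u) [AddCommGroup M] [Module Aᵐᵒᵖ M], Module.Finite Aᵐᵒᵖ M → Nontrivial M →
    ((gradeNumber Aᵐᵒᵖ A M : ENNReal) : EReal) + δ Aᵐᵒᵖ M = d)

/-- The bimodule is finitely generated and reflexive both as a left and as a right module. -/
def AlgBimodule.IsReflexiveOnBothSides {k : Type v} [CommRing k] {A B : Type u} [Ring A]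
    [Algebra k A] [Ring B] [Algebra k B] (M : AlgBimodule k A B) : Prop :=
  IsReflexiveModule A Aᵐᵒᵖ A M ∧ IsReflexiveModule Bᵐᵒᵖ B B M

end

/-! Since `T ⊗ T'` is `(d - 2)`-isomorphic to `B₁`, which has no submodule of dimension less than
`d`, the part `N` of `T` of dimension less than `d` has dimension at most `d - 2`. Hence
`T → (T ⧸ N)**` is a `(d - 2)`-isomorphism: the evaluation map of a torsion-free module is
injective, and its cokernel embeds into an `Ext²`, whose dimension the Auslander and Cohen–Macaulay
conditions bound. The module `(T ⧸ N)**` is reflexive on the right, and also on the other side,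
because a reflexive module has no proper extension of codimension two. By the `γ` condition
tensoring with `T` and `T'` preserves `(d - 2)`-isomorphisms, so the double duals may replace `T`
and `T'`. -/

/-! ### Exact dimension functions -/

namespace DimFunction.IsExact

variable {δ : DimFunction.{u}} {R : Type u} [Ring R] (h : δ.IsExact R)
variable {M N P : Type u} [AddCommGroup M] [Module R M] [AddCommGroup N] [Module R N]
  [AddCommGroup P] [Module R P] {e : EReal}

include h

theorem le_of_subsingleton [Subsingleton M] : δ R M ≤ e :=
  ((h.eq_bot_iff M).2 inferInstance).trans_le bot_le

theorem le_of_injective (f : M →ₗ[R] N) (hf : Function.Injective f) : δ R M ≤ δ R N := by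
  rw [h.congr _ _ (LinearEquiv.ofInjective f hf)]
  exact (le_max_left _ _).trans (h.max_le N (LinearMap.range f))

theorem submodule_le (K : Submodule R M) : δ R K ≤ δ R M :=
  h.le_of_injective K.subtype K.injective_subtype

theorem submodule_mono {K L : Submodule R M} (hKL : K ≤ L) : δ R K ≤ δ R L :=
  h.le_of_injective (Submodule.inclusion hKL) (Submodule.inclusion_injective hKL)

theorem quotient_le (K : Submodule R M) : δ R (M ⧸ K) ≤ δ R M :=
  (le_max_right _ _).trans (h.max_le M K)

theorem le_of_surjective (f : M →ₗ[R] N) (hf : Function.Surjective f) : δ R N ≤ δ R M := by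
  rw [← h.congr _ _ (f.quotKerEquivOfSurjective hf)]
  exact h.quotient_le _

theorem map_le (f : M →ₗ[R] N) (K : Submodule R M) : δ R (K.map f) ≤ δ R K :=
  h.le_of_surjective (f.submoduleMap K) (f.submoduleMap_surjective K)

theorem range_le (f : M →ₗ[R] N) : δ R (LinearMap.range f) ≤ δ R M :=
  h.le_of_surjective f.rangeRestrict f.surjective_rangeRestrict

theorem le_of_exact {f : M →ₗ[R] N} {g : N →ₗ[R] P} (hfg : Function.Exact f g)
    (hM : δ R M ≤ e) (hP : δ R P ≤ e) : δ R N ≤ e := by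
  rw [h.eq_max N (LinearMap.ker g), h.congr _ _ g.quotKerEquivRange, hfg.linearMap_ker_eq]
  exact max_le ((h.range_le f).trans hM) ((h.submodule_le _).trans hP)

theorem le_of_dim_ker_le (f : M →ₗ[R] N) (hk : δ R (LinearMap.ker f) ≤ e) (hN : δ R N ≤ e) :
    δ R M ≤ e :=
  h.le_of_exact f.exact_subtype_ker_map hk hN

theorem le_range_of_ker_le (p : M →ₗ[R] N) (hp : Function.Surjective p) (q : M →ₗ[R] P)
    (hpq : LinearMap.ker q ≤ LinearMap.ker p) : δ R N ≤ δ R (LinearMap.range q) := by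
  rw [← h.congr _ _ q.quotKerEquivRange]
  exact h.le_of_surjective ((LinearMap.ker q).liftQ p hpq)
    (LinearMap.range_eq_top.1 ((Submodule.range_liftQ _ _ _).trans (LinearMap.range_eq_top.2 hp)))

theorem ker_le_of_comp (f : M →ₗ[R] N) (g : N →ₗ[R] P)
    (hgf : δ R (LinearMap.ker (g ∘ₗ f)) ≤ e) : δ R (LinearMap.ker f) ≤ e :=
  (h.submodule_mono (LinearMap.ker_le_ker_comp f g)).trans hgf

theorem ker_comp_le (f : M →ₗ[R] N) (g : N →ₗ[R] P) (hf : δ R (LinearMap.ker f) ≤ e)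
    (hg : δ R (LinearMap.ker g) ≤ e) : δ R (LinearMap.ker (g ∘ₗ f)) ≤ e := by
  refine h.le_of_exact (f := Submodule.inclusion (LinearMap.ker_le_ker_comp f g))
    (g := f.restrict (q := LinearMap.ker g) fun x hx => hx) (fun x => ?_) hf hg
  exact ⟨fun hx => ⟨⟨x, congrArg Subtype.val hx⟩, rfl⟩, by rintro ⟨y, rfl⟩; exact Subtype.ext y.2⟩

theorem coker_comp_le (f : M →ₗ[R] N) (g : N →ₗ[R] P) (hf : δ R (N ⧸ LinearMap.range f) ≤ e)
    (hg : δ R (P ⧸ LinearMap.range g) ≤ e) : δ R (P ⧸ LinearMap.range (g ∘ₗ f)) ≤ e := by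
  have hgf : LinearMap.range f ≤ (LinearMap.range (g ∘ₗ f)).comap g := by
    rintro _ ⟨x, rfl⟩
    exact ⟨x, rfl⟩
  refine h.le_of_exact (f := Submodule.mapQ _ _ g hgf)
    (g := Submodule.factor (LinearMap.range_comp_le_range f g)) (fun x => ?_) hf hg
  obtain ⟨x, rfl⟩ := Submodule.Quotient.mk_surjective _ x
  constructor
  · intro hx
    obtain ⟨n, rfl⟩ : x ∈ LinearMap.range g := (Submodule.Quotient.mk_eq_zero _).1 hx
    exact ⟨Submodule.Quotient.mk n, rfl⟩
  · rintro ⟨n, hn⟩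
    obtain ⟨n, rfl⟩ := Submodule.Quotient.mk_surjective _ n
    rw [← hn]
    exact (Submodule.Quotient.mk_eq_zero _).2 ⟨n, rfl⟩

theorem ker_le_of_comp_of_coker (f : M →ₗ[R] N) (g : N →ₗ[R] P)
    (hf : δ R (N ⧸ LinearMap.range f) ≤ e) (hgf : δ R (LinearMap.ker (g ∘ₗ f)) ≤ e) :
    δ R (LinearMap.ker g) ≤ e := by
  refine h.le_of_exact (f := f.restrict (p := LinearMap.ker (g ∘ₗ f)) fun x hx => hx)
    (g := (LinearMap.range f).mkQ ∘ₗ (LinearMap.ker g).subtype) (fun x => ?_) hgf hf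
  constructor
  · intro hx
    obtain ⟨m, hm⟩ : x.1 ∈ LinearMap.range f := (Submodule.Quotient.mk_eq_zero _).1 hx
    exact ⟨⟨m, (congrArg g hm).trans x.2⟩, Subtype.ext hm⟩
  · rintro ⟨m, rfl⟩
    exact (Submodule.Quotient.mk_eq_zero _).2 ⟨m, rfl⟩

theorem coker_codRestrict_le (f : M →ₗ[R] N) (K : Submodule R N) (hf : ∀ m, f m ∈ K) :
    δ R (K ⧸ LinearMap.range (f.codRestrict K hf)) ≤ δ R (N ⧸ LinearMap.range f) := by
  have hrange := LinearMap.range_codRestrict K f hf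
  refine h.le_of_injective (Submodule.mapQ _ (LinearMap.range f) K.subtype hrange.le) ?_
  rw [← LinearMap.ker_eq_bot, Submodule.ker_mapQ, ← hrange, Submodule.mkQ_map_self]

theorem prod_le (hM : δ R M ≤ e) (hN : δ R N ≤ e) : δ R (M × N) ≤ e :=
  h.le_of_exact (f := LinearMap.inl R M N) (g := LinearMap.snd R M N) .inl_snd hM hN

theorem pi_le (hM : δ R M ≤ e) (n : ℕ) : δ R (Fin n → M) ≤ e := by
  induction n with
  | zero => exact h.le_of_subsingleton
  | succ n ih =>
    exact (h.congr _ _ (Fin.consLinearEquiv R fun _ : Fin (n + 1) => M)).symm.trans_le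
      (h.prod_le hM ih)

theorem sup_le {K L : Submodule R M} (hK : δ R K ≤ e) (hL : δ R L ≤ e) :
    δ R (K ⊔ L : Submodule R M) ≤ e := by
  rw [Submodule.sup_eq_range]
  exact (h.range_le _).trans (h.prod_le hK hL)

end DimFunction.IsExact

namespace DimFunction

variable (δ : DimFunction.{u}) (e : EReal) (R : Type u) [Ring R] (M : Type u) [AddCommGroup M]
  [Module R M]

/-- The largest submodule of dimension at most `e`, encoded as the supremum of all of them. -/
def torsion : Submodule R M := sSup {N | δ R N ≤ e}

/-- Purity of `M` above dimension `e`: no nonzero submodule has dimension at most `e`. -/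
def IsTorsionFree : Prop := ∀ N : Submodule R M, δ R N ≤ e → N = ⊥

variable {δ e R M}

theorem le_torsion {N : Submodule R M} (hN : δ R N ≤ e) : N ≤ torsion δ e R M :=
  le_sSup hN

theorem IsExact.torsion_le (h : δ.IsExact R) : δ R (torsion δ e R M) ≤ e := by
  rw [torsion, h.sSup_directed]
  · exact iSup₂_le fun N hN => hN
  · exact ⟨⊥, h.le_of_subsingleton⟩
  · exact fun K hK L hL => ⟨K ⊔ L, h.sup_le hK hL, le_sup_left, le_sup_right⟩

theorem IsExact.map_mem_torsion (h : δ.IsExact R) {N : Type u} [AddCommGroup N] [Module R N]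
    (φ : M →ₗ[R] N) {m : M} (hm : m ∈ torsion δ e R M) : φ m ∈ torsion δ e R N :=
  le_torsion ((h.map_le φ _).trans h.torsion_le) (Submodule.mem_map_of_mem hm)

theorem IsExact.isTorsionFree_quotient_torsion (h : δ.IsExact R) :
    IsTorsionFree δ e R (M ⧸ torsion δ e R M) := by
  intro N hN
  set π := (torsion δ e R M).mkQ
  have hcomap : N.comap π ≤ torsion δ e R M := by
    refine le_torsion (h.le_of_exact
      (f := Submodule.inclusion (p := torsion δ e R M) fun x hx => ?_)
      (g := π.restrict (p := N.comap π) (q := N) fun x hx => hx) (fun x => ?_) h.torsion_le hN)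
    · rw [Submodule.mem_comap, show π x = 0 from (Submodule.Quotient.mk_eq_zero _).2 hx]
      exact N.zero_mem
    · rw [← Subtype.coe_inj]
      exact (Submodule.Quotient.mk_eq_zero _).trans
        ⟨fun hx => ⟨⟨x, hx⟩, rfl⟩, by rintro ⟨y, rfl⟩; exact y.2⟩
  rw [← Submodule.map_comap_eq_of_surjective (Submodule.mkQ_surjective _) N, eq_bot_iff,
    Submodule.map_le_iff_le_comap]
  exact hcomap.trans_eq (Submodule.ker_mkQ _).symm

theorem isTorsionFree_of_torsion_eq_bot (htf : torsion δ e R M = ⊥) : IsTorsionFree δ e R M :=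
  fun _ hN => eq_bot_iff.2 (htf ▸ le_torsion hN)

theorem IsTorsionFree.of_injective (h : δ.IsExact R) {N : Type u} [AddCommGroup N] [Module R N]
    (htf : IsTorsionFree δ e R N) (f : M →ₗ[R] N) (hf : Function.Injective f) :
    IsTorsionFree δ e R M := fun K hK =>
  Submodule.map_injective_of_injective hf
    ((htf _ ((h.map_le f K).trans hK)).trans (Submodule.map_bot f).symm)

end DimFunction

/-! ### `Ext` into a bimodule -/

theorem shortExact_moduleCat {S X Y Z : Type u} [Ring S] [AddCommGroup X] [Module S X]
    [AddCommGroup Y] [Module S Y] [AddCommGroup Z] [Module S Z] {f : X →ₗ[S] Y} {g : Y →ₗ[S] Z}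
    (hf : Function.Injective f) (hfg : Function.Exact f g) (hg : Function.Surjective g) :
    (ShortComplex.mk (ModuleCat.ofHom f) (ModuleCat.ofHom g) (by
      ext x; exact hfg.apply_apply_eq_zero x)).ShortExact where
  exact := (ShortComplex.ShortExact.moduleCat_exact_iff_function_exact _).2 hfg
  mono_f := (ModuleCat.mono_iff_injective _).2 hf
  epi_g := (ModuleCat.epi_iff_surjective _).2 hg

namespace ExtMod

open Abelian

variable {R S D : Type u} [Ring R] [Ring S] [AddCommGroup D] [Module R D] [Module S D]
variable {X Y Z : Type u} [AddCommGroup X] [Module S X] [AddCommGroup Y] [Module S Y]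
  [AddCommGroup Z] [Module S Z] {f : X →ₗ[S] Y} {g : Y →ₗ[S] Z}

theorem subsingleton_of_subsingleton [Subsingleton X] (q : ℕ) :
    Subsingleton (ExtMod S D X q) := by
  have hX : Limits.IsZero (ModuleCat.of S X) := ModuleCat.isZero_of_subsingleton _
  refine subsingleton_of_forall_eq (α := Ext.{u} (ModuleCat.of S X) (ModuleCat.of S D) q) 0
    fun x => ?_
  rw [← Ext.mk₀_id_comp x, hX.eq_of_src (𝟙 _) 0, Ext.mk₀_zero, Ext.zero_comp]

theorem ofHom_bijective :
    Function.Bijective (fun φ : X →ₗ[S] D => (Ext.mk₀ (ModuleCat.ofHom φ) : ExtMod S D X 0)) :=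
  (Ext.homEquiv₀ (X := ModuleCat.of S X) (Y := ModuleCat.of S D)).symm.bijective.comp
    (ModuleCat.homEquiv (M := ModuleCat.of S X) (N := ModuleCat.of S D)).symm.bijective

theorem linearMap_eq_zero_of_subsingleton (hX : Subsingleton (ExtMod S D X 0)) (φ : X →ₗ[S] D) :
    φ = 0 :=
  ofHom_bijective.1 (hX.elim _ _)

variable [SMulCommClass R S D]

/-- The identification of `Hom` with `Ext` in degree zero, linear for the action of `R` on the
coefficients. -/
noncomputable def ofHom (R S D X : Type u) [Ring R] [Ring S] [AddCommGroup D] [Module R D]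
    [Module S D] [SMulCommClass R S D] [SMulCommClass S R D] [AddCommGroup X] [Module S X] :
    (X →ₗ[S] D) →ₗ[R] ExtMod S D X 0 where
  toFun φ := Ext.mk₀ (ModuleCat.ofHom φ)
  map_add' _ _ := Ext.mk₀_add _ _
  map_smul' r φ := (Ext.mk₀_comp_mk₀ (ModuleCat.ofHom φ)
    (ModuleCat.ofHom (DistribSMul.toLinearMap S D r))).symm

/-- The connecting map `Ext^q(X, D) → Ext^{q+1}(Z, D)` of a short exact sequence
`0 → X → Y → Z → 0`, linear for the action of `R` on the coefficients. -/
noncomputable def connecting (R D : Type u) [Ring R] [AddCommGroup D] [Module R D]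
    [Module S D] [SMulCommClass R S D] (hf : Function.Injective f)
    (hfg : Function.Exact f g) (hg : Function.Surjective g) (q : ℕ) :
    ExtMod S D X q →ₗ[R] ExtMod S D Z (q + 1) where
  toFun x := Ext.comp (shortExact_moduleCat hf hfg hg).extClass
    (x : Ext.{u} (ModuleCat.of S X) (ModuleCat.of S D) q) (add_comm 1 q)
  map_add' _ _ := Ext.comp_add _ _ _ _
  map_smul' r x :=
    (Ext.comp_assoc (shortExact_moduleCat hf hfg hg).extClass
      (x : Ext.{u} (ModuleCat.of S X) (ModuleCat.of S D) q)
      (Ext.mk₀ (ModuleCat.ofHom (DistribSMul.toLinearMap S D r))) (add_comm 1 q) (add_zero q)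
      (by omega)).symm

theorem exists_extension_of_connecting_eq_zero [SMulCommClass S R D] (hf : Function.Injective f)
    (hfg : Function.Exact f g) (hg : Function.Surjective g) (φ : X →ₗ[S] D)
    (hφ : connecting R D hf hfg hg 0 (ofHom R S D X φ) = 0) : ∃ ψ : Y →ₗ[S] D, ψ ∘ₗ f = φ := by
  obtain ⟨x, hx⟩ := Ext.contravariant_sequence_exact₁ (shortExact_moduleCat hf hfg hg)
    (ModuleCat.of S D) (Ext.mk₀ (ModuleCat.ofHom φ)) (add_comm 1 0) hφ
  obtain ⟨ψ, rfl⟩ := ofHom_bijective.2 x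
  exact ⟨ψ, ofHom_bijective.1
    ((Ext.mk₀_comp_mk₀ (ModuleCat.ofHom f) (ModuleCat.ofHom ψ)).symm.trans hx)⟩

theorem connecting_one_injective [Module.Projective S Y] (hf : Function.Injective f)
    (hfg : Function.Exact f g) (hg : Function.Surjective g) :
    Function.Injective (connecting R D hf hfg hg 1) := by
  rw [injective_iff_map_eq_zero]
  intro x hx
  obtain ⟨y, hy⟩ := Ext.contravariant_sequence_exact₁ (shortExact_moduleCat hf hfg hg)
    (ModuleCat.of S D) (x : Ext.{u} (ModuleCat.of S X) (ModuleCat.of S D) 1) (add_comm 1 1) hx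
  have : Projective (ModuleCat.of S Y) := (IsProjective.iff_projective Y).1 inferInstance
  rw [Ext.eq_zero_of_projective y, Ext.comp_zero] at hy
  exact hy.symm

end ExtMod

/-! ### Grade numbers and dimension -/

namespace DimFunction

/-- The extended real number `d - q`, the dimension of a module of grade `q`. -/
def codim (d q : ℕ) : EReal := ((((d : ℤ) - (q : ℤ) : ℤ) : ℝ) : EReal)

theorem codim_strictAnti (d : ℕ) : StrictAnti (codim d) := fun _ _ hpq =>
  EReal.coe_lt_coe_iff.2 (Int.cast_lt.2 (by omega))

theorem exists_eq_codim_of_add_eq {d : ℕ} {j : ℕ∞} {x : EReal}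
    (h : ((j : ENNReal) : EReal) + x = d) : ∃ n : ℕ, j = n ∧ x = codim d n := by
  have hx_bot : x ≠ ⊥ := by
    rintro rfl
    exact EReal.natCast_ne_bot d (h.symm.trans (EReal.add_bot _))
  have hj : j ≠ ⊤ := by
    rintro rfl
    rw [ENat.toENNReal_top, EReal.coe_ennreal_top, EReal.top_add_of_ne_bot hx_bot] at h
    exact EReal.natCast_ne_top d h.symm
  have hx_top : x ≠ ⊤ := by
    rintro rfl
    rw [EReal.add_top_of_ne_bot (EReal.coe_ennreal_ne_bot _)] at h
    exact EReal.natCast_ne_top d h.symm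
  lift j to ℕ using hj
  lift x to ℝ using ⟨hx_top, hx_bot⟩
  have hreal : (j : ℝ) + x = d := by
    rw [ENat.toENNReal_coe, show (((j : ENNReal)) : EReal) = ((j : ℝ) : EReal) from
      EReal.coe_nnreal_eq_coe_real (j : NNReal)] at h
    exact_mod_cast h
  refine ⟨j, rfl, EReal.coe_eq_coe_iff.2 ?_⟩
  push_cast
  exact eq_sub_of_add_eq' hreal

/-- One half of the Auslander–Gorenstein and Cohen–Macaulay conditions on a ring `A`. Here `D` is
`A` itself and `(R, S)` is `(A, Aᵐᵒᵖ)` or `(Aᵐᵒᵖ, A)`, so that every statement on `R`-modules holds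
on both sides of `A`. -/
structure IsDualizing (δ : DimFunction.{u}) (d : ℕ) (R S D : Type u) [Ring R] [Ring S]
    [AddCommGroup D] [Module R D] [Module S D] [SMulCommClass R S D] [SMulCommClass S R D] :
    Prop where
  exact : δ.IsExact R
  noeth_left : IsNoetherianRing R
  noeth_right : IsNoetherianRing S
  finite_left : Module.Finite R D
  finite_right : Module.Finite S D
  free_right : Module.Free S D
  bijective_toModuleEnd : Function.Bijective (Module.toModuleEnd S (S := R) D)
  grade_add_dim : ∀ (M : Type u) [AddCommGroup M] [Module R M], Module.Finite R M →
    Nontrivial M → ((gradeNumber R D M : ENNReal) : EReal) + δ R M = d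
  auslander : ∀ (M : Type u) [AddCommGroup M] [Module S M], Module.Finite S M →
    AuslanderCondition S R D M

namespace IsDualizing

variable {δ : DimFunction.{u}} {d : ℕ} {R S D : Type u} [Ring R] [Ring S]
    [AddCommGroup D] [Module R D] [Module S D] [SMulCommClass R S D] [SMulCommClass S R D]
    (h : δ.IsDualizing d R S D)
variable {M : Type u} [AddCommGroup M] [Module R M]

include h

theorem dim_le_of_le_gradeNumber [Module.Finite R M] {q : ℕ}
    (hq : (q : ℕ∞) ≤ gradeNumber R D M) : δ R M ≤ codim d q := by
  rcases subsingleton_or_nontrivial M with hM | hM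
  · exact h.exact.le_of_subsingleton
  obtain ⟨j, hj, hdim⟩ := exists_eq_codim_of_add_eq (h.grade_add_dim M inferInstance hM)
  rw [hj, Nat.cast_le] at hq
  exact hdim.trans_le ((codim_strictAnti d).antitone hq)

theorem subsingleton_ext [Module.Finite R M] {q i : ℕ} (hM : δ R M ≤ codim d q) (hi : i < q) :
    Subsingleton (ExtMod R D M i) := by
  rcases subsingleton_or_nontrivial M with hs | hs
  · exact ExtMod.subsingleton_of_subsingleton i
  obtain ⟨j, hj, hdim⟩ := exists_eq_codim_of_add_eq (h.grade_add_dim M inferInstance hs)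
  have hqj : q ≤ j := by
    rwa [hdim, (codim_strictAnti d).le_iff_ge] at hM
  by_contra hne
  have hji : gradeNumber R D M ≤ i := iInf₂_le i (not_subsingleton_iff_nontrivial.1 hne)
  rw [hj, Nat.cast_le] at hji
  omega

theorem linearMap_eq_zero [Module.Finite R M] (hM : δ R M ≤ codim d 1) (f : M →ₗ[R] D) : f = 0 :=
  ExtMod.linearMap_eq_zero_of_subsingleton (h.subsingleton_ext hM zero_lt_one) f

theorem exists_extension {N : Type u} [AddCommGroup N] [Module R N] (i : M →ₗ[R] N)
    (hi : Function.Injective i) [Module.Finite R (N ⧸ LinearMap.range i)]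
    (hN : δ R (N ⧸ LinearMap.range i) ≤ codim d 2) (f : M →ₗ[R] D) :
    ∃ g : N →ₗ[R] D, g ∘ₗ i = f :=
  ExtMod.exists_extension_of_connecting_eq_zero (R := S) hi (LinearMap.exact_map_mkQ_range i)
    (Submodule.mkQ_surjective _) f ((h.subsingleton_ext hN one_lt_two).elim _ _)

theorem dim_range_le {N : Type u} [AddCommGroup N] [Module S N] [Module.Finite S N]
    [Module.Finite R M] {q : ℕ} (c : M →ₗ[R] ExtMod S D N q) :
    δ R (LinearMap.range c) ≤ codim d q :=
  h.dim_le_of_le_gradeNumber (h.auslander N inferInstance q (LinearMap.range c))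

end IsDualizing

end DimFunction

/-! ### Duals and double duals -/

section DoubleDual

variable (R S D M : Type u) [Ring R] [Ring S] [AddCommGroup D] [Module R D] [Module S D]
  [SMulCommClass R S D] [SMulCommClass S R D] [AddCommGroup M] [Module R M]

/-- The double dual of an `R`-module with respect to the bimodule `D`. It is not an abbreviation,
because a further action on `M` will act on it through `M` and not through the values in `D`. -/
def DoubleDual : Type u := (M →ₗ[R] D) →ₗ[S] D

namespace DoubleDual

instance : AddCommGroup (DoubleDual R S D M) :=
  inferInstanceAs (AddCommGroup ((M →ₗ[R] D) →ₗ[S] D))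

instance : Module R (DoubleDual R S D M) :=
  inferInstanceAs (Module R ((M →ₗ[R] D) →ₗ[S] D))

variable {R S D M}

/-- An element of the double dual, as a linear map on the dual. -/
def toHom (F : DoubleDual R S D M) : (M →ₗ[R] D) →ₗ[S] D := F

omit [SMulCommClass S R D] in
@[ext]
theorem ext {F G : DoubleDual R S D M} (hFG : ∀ φ, F.toHom φ = G.toHom φ) : F = G :=
  LinearMap.ext (f := F.toHom) (g := G.toHom) hFG

variable (R S D M) in
/-- `toDoubleDual` as a linear map. -/
def eval : M →ₗ[R] DoubleDual R S D M where
  toFun := toDoubleDual R S D M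
  map_add' m n := ext fun φ => map_add φ m n
  map_smul' r m := ext fun φ => map_smul φ r m

theorem eval_toHom (m : M) (φ : M →ₗ[R] D) : (eval R S D M m).toHom φ = φ m := rfl

/-- The functional on the double dual given by evaluation at a functional `φ` on `M`. -/
def apply (φ : M →ₗ[R] D) : DoubleDual R S D M →ₗ[R] D where
  toFun F := F.toHom φ
  map_add' _ _ := rfl
  map_smul' _ _ := rfl

variable {N : Type u} [AddCommGroup N] [Module R N]

/-- The functoriality of the double dual. -/
def map (f : M →ₗ[R] N) : DoubleDual R S D M →ₗ[R] DoubleDual R S D N :=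
  LinearMap.lcomp R D (LinearMap.lcomp S D f)

section Action

variable (Q : Type u) [Ring Q] [Module Q M] [SMulCommClass Q R M]

/-- The action on the double dual induced by an action on the module. -/
instance action : Module Q (DoubleDual R S D M) where
  smul q F := map (DistribSMul.toLinearMap R M q) F
  one_smul F := ext fun φ => congrArg F.toHom (LinearMap.ext fun m => by simp)
  mul_smul q q' F := ext fun φ => congrArg F.toHom (LinearMap.ext fun m => by simp [mul_smul])
  smul_zero q := rfl
  smul_add q F G := rfl
  add_smul q q' F := ext fun φ => (congrArg F.toHom (LinearMap.ext fun m => by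
    simp [add_smul])).trans (map_add F.toHom _ _)
  zero_smul F := ext fun φ => (congrArg F.toHom (LinearMap.ext fun m => by
    simp)).trans (map_zero F.toHom)

instance : SMulCommClass Q R (DoubleDual R S D M) := ⟨fun _ _ _ => rfl⟩

end Action

end DoubleDual

end DoubleDual

section FiniteFree

variable (R S D : Type u) [Ring R] [Ring S] [AddCommGroup D] [Module R D] [Module S D]
  [SMulCommClass R S D]

/-- The dual of `R^n` with respect to `D` is `D^n`. -/
def dualPiEquiv (n : ℕ) : ((Fin n → R) →ₗ[R] D) ≃ₗ[S] (Fin n → D) :=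
  (LinearMap.lsum R (fun _ : Fin n => R) S).symm.trans
    (LinearEquiv.piCongrRight fun _ => LinearMap.ringLmapEquivSelf R S D)

variable {R S D}

theorem finite_dual {M : Type u} [AddCommGroup M] [Module R M] [IsNoetherianRing S]
    [Module.Finite S D] [Module.Finite R M] : Module.Finite S (M →ₗ[R] D) := by
  obtain ⟨n, f, hf⟩ := Module.Finite.exists_fin' R M
  have : IsNoetherian S D := isNoetherian_of_isNoetherianRing_of_finite S D
  refine Module.Finite.of_injective
    ((dualPiEquiv R S D n).toLinearMap ∘ₗ LinearMap.lcomp S D f) ?_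
  exact (dualPiEquiv R S D n).injective.comp fun φ ψ hφψ => (LinearMap.cancel_right hf).1 hφψ

theorem exact_lcomp {M F F' : Type u} [AddCommGroup M] [Module R M] [AddCommGroup F] [Module R F]
    [AddCommGroup F'] [Module R F'] {π : F →ₗ[R] M} {ρ : F' →ₗ[R] F} (hρπ : Function.Exact ρ π)
    (hπ : Function.Surjective π) :
    Function.Exact (LinearMap.lcomp S D π : (M →ₗ[R] D) →ₗ[S] (F →ₗ[R] D))
      (LinearMap.lcomp S D ρ : (F →ₗ[R] D) →ₗ[S] (F' →ₗ[R] D)) := by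
  intro f
  constructor
  · intro hf
    have hle : LinearMap.range ρ ≤ LinearMap.ker f := by
      rintro _ ⟨x, rfl⟩
      exact LinearMap.congr_fun hf x
    refine ⟨(LinearMap.range ρ).liftQ f hle ∘ₗ (hρπ.linearEquivOfSurjective hπ).symm.toLinearMap,
      LinearMap.ext fun x => ?_⟩
    refine (congrArg ((LinearMap.range ρ).liftQ f hle) ?_).trans (Submodule.liftQ_apply _ f x)
    exact (hρπ.linearEquivOfSurjective hπ).symm_apply_apply (Submodule.Quotient.mk x)
  · rintro ⟨φ, rfl⟩
    ext x
    exact (congrArg φ (hρπ.apply_apply_eq_zero x)).trans (map_zero φ)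

end FiniteFree

namespace DimFunction.IsDualizing

open DoubleDual

variable {δ : DimFunction.{u}} {d : ℕ} {R S D : Type u} [Ring R] [Ring S]
    [AddCommGroup D] [Module R D] [Module S D] [SMulCommClass R S D] [SMulCommClass S R D]
    (h : δ.IsDualizing d R S D)
variable {M : Type u} [AddCommGroup M] [Module R M]

include h

theorem projective_dual_pi (n : ℕ) : Module.Projective S ((Fin n → R) →ₗ[R] D) := by
  have := h.free_right
  exact Module.Projective.of_equiv (dualPiEquiv R S D n).symm

theorem eval_pi_bijective (n : ℕ) : Function.Bijective (eval R S D (Fin n → R)) := by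
  constructor
  · rw [injective_iff_map_eq_zero]
    refine fun x hx => funext fun j => h.bijective_toModuleEnd.1 (LinearMap.ext fun c => ?_)
    rw [Pi.zero_apply, map_zero]
    exact congrArg (fun F => F.toHom ((LinearMap.proj j).smulRight c)) hx
  · intro F
    let coord (j : Fin n) : D →ₗ[S] ((Fin n → R) →ₗ[R] D) :=
      (dualPiEquiv R S D n).symm.toLinearMap ∘ₗ LinearMap.single S (fun _ => D) j
    choose r hr using fun j => h.bijective_toModuleEnd.2 (F.toHom ∘ₗ coord j)
    refine ⟨r, DoubleDual.ext fun φ => ?_⟩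
    obtain ⟨c, rfl⟩ := (dualPiEquiv R S D n).symm.surjective φ
    rw [eval_toHom, ← Finset.univ_sum_single c, map_sum, map_sum, LinearMap.sum_apply]
    refine Finset.sum_congr rfl fun j _ => Eq.trans ?_ (LinearMap.congr_fun (hr j) (c j))
    simp [dualPiEquiv, Pi.single_apply, LinearMap.sum_apply]

theorem exists_presentation (M : Type u) [AddCommGroup M] [Module R M] [Module.Finite R M] :
    ∃ (n m : ℕ) (π : (Fin n → R) →ₗ[R] M) (ρ : (Fin m → R) →ₗ[R] (Fin n → R)),
      Function.Surjective π ∧ Function.Exact ρ π := by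
  have := h.noeth_left
  obtain ⟨n, π, hπ⟩ := Module.Finite.exists_fin' R M
  obtain ⟨m, ρ, hρ⟩ := Module.Finite.exists_fin' R (LinearMap.ker π)
  refine ⟨n, m, π, (LinearMap.ker π).subtype ∘ₗ ρ, hπ, LinearMap.exact_iff.2 ?_⟩
  rw [LinearMap.range_comp, LinearMap.range_eq_top.2 hρ, Submodule.map_top, Submodule.range_subtype]

theorem finite_doubleDual [Module.Finite R M] : Module.Finite R (DoubleDual R S D M) := by
  have := h.noeth_left
  have := h.noeth_right
  have := h.finite_left
  have := h.finite_right
  have : Module.Finite S (M →ₗ[R] D) := finite_dual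
  exact (finite_dual : Module.Finite R ((M →ₗ[R] D) →ₗ[S] D))

theorem dim_coker_eval_le [Module.Finite R M] :
    δ R (DoubleDual R S D M ⧸ LinearMap.range (eval R S D M)) ≤ codim d 2 := by
  obtain ⟨n, m, π, ρ, hπ, hρπ⟩ := h.exists_presentation M
  have := h.noeth_right
  have := h.finite_right
  have := h.finite_doubleDual (M := M)
  have := h.projective_dual_pi m
  have : Module.Finite S ((Fin m → R) →ₗ[R] D) := finite_dual
  let Φ : ((Fin n → R) →ₗ[R] D) →ₗ[S] ((Fin m → R) →ₗ[R] D) := LinearMap.lcomp S D ρ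
  have hinj : Function.Injective (LinearMap.lcomp S D π : (M →ₗ[R] D) →ₗ[S] _) :=
    fun _ _ => (LinearMap.cancel_right hπ).1
  have hex : Function.Exact (LinearMap.lcomp S D π : (M →ₗ[R] D) →ₗ[S] _) Φ.rangeRestrict :=
    LinearMap.exact_iff.2 (Φ.ker_rangeRestrict.trans (LinearMap.exact_iff.1 (exact_lcomp hρπ hπ)))
  let c₁ := ExtMod.connecting R D hinj hex Φ.surjective_rangeRestrict 0 ∘ₗ
    ExtMod.ofHom R S D (M →ₗ[R] D)
  have hinj' := (LinearMap.range Φ).injective_subtype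
  have hex' := LinearMap.exact_subtype_mkQ (LinearMap.range Φ)
  have hsurj' := (LinearMap.range Φ).mkQ_surjective
  let c : DoubleDual R S D M →ₗ[R] ExtMod S D (((Fin m → R) →ₗ[R] D) ⧸ LinearMap.range Φ) 2 :=
    ExtMod.connecting R D hinj' hex' hsurj' 1 ∘ₗ c₁
  refine (h.exact.le_range_of_ker_le (LinearMap.range (eval R S D M)).mkQ
    (Submodule.mkQ_surjective _) c fun F hF => ?_).trans (h.dim_range_le c)
  have hF₁ : c₁ F = 0 :=
    ExtMod.connecting_one_injective (R := R) hinj' hex' hsurj' (Eq.trans hF (map_zero _).symm)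
  obtain ⟨f, hf⟩ := ExtMod.exists_extension_of_connecting_eq_zero hinj hex
    Φ.surjective_rangeRestrict F.toHom hF₁
  obtain ⟨x, rfl⟩ := (h.eval_pi_bijective n).2 f
  rw [Submodule.ker_mkQ]
  exact ⟨π x, DoubleDual.ext fun φ => LinearMap.congr_fun hf φ⟩

theorem exists_range_eq_ker_eval {n : ℕ} {F I : Type u} [AddCommGroup F] [Module R F]
    [AddCommGroup I] [Module S I] {π : (Fin n → R) →ₗ[R] M} {ρ : F →ₗ[R] (Fin n → R)}
    (hπ : Function.Surjective π) {Φ : ((Fin n → R) →ₗ[R] D) →ₗ[S] I} {ι : I →ₗ[S] (F →ₗ[R] D)}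
    (hΦ : Function.Exact (LinearMap.lcomp S D π : (M →ₗ[R] D) →ₗ[S] _) Φ)
    (hι : ι ∘ₗ Φ = LinearMap.lcomp S D ρ) (hΦ' : Function.Surjective Φ) :
    ∃ θ : (I →ₗ[S] D) →ₗ[R] M, LinearMap.range θ = LinearMap.ker (eval R S D M) ∧
      ∀ x : F, θ ((eval R S D F x).toHom ∘ₗ ι) = π (ρ x) := by
  let ω := LinearEquiv.ofBijective _ (h.eval_pi_bijective n)
  refine ⟨π ∘ₗ ω.symm.toLinearMap ∘ₗ LinearMap.lcomp R D Φ, le_antisymm ?_ ?_, fun x => ?_⟩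
  · rintro _ ⟨f, rfl⟩
    refine DoubleDual.ext fun φ => ?_
    refine (congrArg (fun F => F.toHom (φ ∘ₗ π)) (ω.apply_symm_apply (f ∘ₗ Φ))).trans ?_
    exact (congrArg f (hΦ.apply_apply_eq_zero φ)).trans (map_zero f)
  · intro y hy
    obtain ⟨x, rfl⟩ := hπ y
    obtain ⟨f, hf⟩ := (exact_lcomp (S := R) (D := D) hΦ hΦ' (eval R S D _ x).toHom).1 hy
    exact ⟨f, congrArg π (ω.symm_apply_eq.2 hf)⟩
  · refine congrArg π (ω.symm_apply_eq.2 (DoubleDual.ext fun φ => ?_))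
    exact LinearMap.congr_fun (LinearMap.congr_fun hι φ) x

theorem dim_ker_eval_le [Module.Finite R M] :
    δ R (LinearMap.ker (eval R S D M)) ≤ codim d 1 := by
  obtain ⟨n, m, π, ρ, hπ, hρπ⟩ := h.exists_presentation M
  have := h.noeth_left
  have := h.noeth_right
  have := h.finite_left
  have := h.finite_right
  have : Module.Finite S ((Fin m → R) →ₗ[R] D) := finite_dual
  let Φ : ((Fin n → R) →ₗ[R] D) →ₗ[S] ((Fin m → R) →ₗ[R] D) := LinearMap.lcomp S D ρ
  have : Module.Finite R (LinearMap.range Φ →ₗ[S] D) := finite_dual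
  obtain ⟨θ, hθ, hθρ⟩ := h.exists_range_eq_ker_eval hπ
    (LinearMap.exact_iff.2 (Φ.ker_rangeRestrict.trans (LinearMap.exact_iff.1 (exact_lcomp hρπ hπ))))
    (ι := (LinearMap.range Φ).subtype) rfl Φ.surjective_rangeRestrict
  have hinj := (LinearMap.range Φ).injective_subtype
  have hex := LinearMap.exact_subtype_mkQ (LinearMap.range Φ)
  have hsurj := (LinearMap.range Φ).mkQ_surjective
  let c := ExtMod.connecting R D hinj hex hsurj 0 ∘ₗ ExtMod.ofHom R S D (LinearMap.range Φ)
  rw [← hθ]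
  refine (h.exact.le_range_of_ker_le θ.rangeRestrict θ.surjective_rangeRestrict c
    fun f hf => ?_).trans (h.dim_range_le c)
  obtain ⟨g, rfl⟩ := ExtMod.exists_extension_of_connecting_eq_zero hinj hex hsurj f hf
  obtain ⟨s, rfl⟩ := (h.eval_pi_bijective m).2 g
  exact Subtype.ext ((hθρ s).trans (hρπ.apply_apply_eq_zero s))

end DimFunction.IsDualizing

namespace DimFunction.IsDualizing

open DoubleDual

variable {δ : DimFunction.{u}} {d : ℕ} {R S D : Type u} [Ring R] [Ring S]
    [AddCommGroup D] [Module R D] [Module S D] [SMulCommClass R S D] [SMulCommClass S R D]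
    (h : δ.IsDualizing d R S D)
variable {M : Type u} [AddCommGroup M] [Module R M] {L : Type u} [AddCommGroup L] [Module R L]

include h

theorem eval_injective [Module.Finite R M] (hM : IsTorsionFree δ (codim d 1) R M) :
    Function.Injective (eval R S D M) :=
  LinearMap.ker_eq_bot.1 (hM _ h.dim_ker_eval_le)

theorem isTorsionFree_self : IsTorsionFree δ (codim d 1) R D := by
  intro W hW
  have := h.noeth_left
  have := h.finite_left
  rw [eq_bot_iff]
  exact fun x hx => LinearMap.congr_fun (h.linearMap_eq_zero hW W.subtype) ⟨x, hx⟩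

theorem isTorsionFree_doubleDual [Module.Finite R M] :
    IsTorsionFree δ (codim d 1) R (DoubleDual R S D M) := by
  intro W hW
  have := h.noeth_left
  have := h.finite_doubleDual (M := M)
  rw [eq_bot_iff]
  exact fun F hF => DoubleDual.ext fun φ =>
    LinearMap.congr_fun (h.linearMap_eq_zero hW (apply φ ∘ₗ W.subtype)) ⟨F, hF⟩

theorem lcomp_injective {i : M →ₗ[R] L} [Module.Finite R L]
    (hi : δ R (L ⧸ LinearMap.range i) ≤ codim d 1) :
    Function.Injective (LinearMap.lcomp S D i : (L →ₗ[R] D) →ₗ[S] (M →ₗ[R] D)) := by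
  rw [injective_iff_map_eq_zero]
  intro ψ hψ
  have hle : LinearMap.range i ≤ LinearMap.ker ψ :=
    LinearMap.range_le_ker_iff.2 hψ
  rw [← Submodule.liftQ_mkQ _ ψ hle, h.linearMap_eq_zero hi (Submodule.liftQ _ ψ hle),
    LinearMap.zero_comp]

theorem lcomp_bijective {i : M →ₗ[R] L} [Module.Finite R L] (hi : Function.Injective i)
    (hcoker : δ R (L ⧸ LinearMap.range i) ≤ codim d 2) :
    Function.Bijective (LinearMap.lcomp S D i : (L →ₗ[R] D) →ₗ[S] (M →ₗ[R] D)) :=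
  ⟨h.lcomp_injective (hcoker.trans ((codim_strictAnti d).antitone one_le_two)),
    fun φ => h.exists_extension i hi hcoker φ⟩

theorem isReflexiveModule_doubleDual [Module.Finite R M] :
    IsReflexiveModule R S D (DoubleDual R S D M) := by
  have hfin := h.finite_doubleDual (M := M)
  have eq_apply (ψ : DoubleDual R S D M →ₗ[R] D) : ψ = apply (ψ ∘ₗ eval R S D M) :=
    h.lcomp_injective (h.dim_coker_eval_le.trans ((codim_strictAnti d).antitone one_le_two)) rfl
  refine ⟨hfin, fun F G hFG => ?_, fun G => ?_⟩
  · exact DoubleDual.ext fun φ => LinearMap.congr_fun hFG (apply φ)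
  · let applyₗ : (M →ₗ[R] D) →ₗ[S] (DoubleDual R S D M →ₗ[R] D) :=
      { toFun := apply
        map_add' := fun φ ψ => LinearMap.ext fun F => map_add F.toHom φ ψ
        map_smul' := fun s φ => LinearMap.ext fun F => map_smul F.toHom s φ }
    exact ⟨G ∘ₗ applyₗ, LinearMap.ext fun ψ =>
      (LinearMap.congr_fun (eq_apply ψ) _).trans (congrArg G (eq_apply ψ).symm)⟩

theorem surjective_of_comap_range_eval_le {N : Type u} [AddCommGroup N] [Module R N]
    [Module.Finite R L] (hL : IsTorsionFree δ (codim d 1) R L) (f : M →ₗ[R] N) (g : N →ₗ[R] L)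
    (hgf : Function.Injective (g ∘ₗ f))
    (hcoker : δ R (L ⧸ LinearMap.range (g ∘ₗ f)) ≤ codim d 2)
    (hle : (LinearMap.range (eval R S D L)).comap (DoubleDual.map (g ∘ₗ f)) ≤
      (LinearMap.range (eval R S D N)).comap (DoubleDual.map f)) : Function.Surjective g := by
  intro l
  let e := LinearEquiv.ofBijective _ (h.lcomp_bijective hgf hcoker)
  let F : DoubleDual R S D M := (eval R S D L l).toHom ∘ₗ e.symm.toLinearMap
  have hF : DoubleDual.map (g ∘ₗ f) F = eval R S D L l := DoubleDual.ext fun ψ =>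
    congrArg (eval R S D L l).toHom (e.symm_apply_apply ψ)
  obtain ⟨n, hn⟩ := hle (show F ∈ (LinearMap.range _).comap _ from ⟨l, hF.symm⟩)
  refine ⟨n, h.eval_injective hL (Eq.trans ?_ hF)⟩
  exact DoubleDual.ext fun ψ => congrArg (fun G => G.toHom (ψ ∘ₗ g)) hn

theorem surjective_of_isReflexiveModule (hM : IsReflexiveModule R S D M) [Module.Finite R L]
    (hL : IsTorsionFree δ (codim d 1) R L) (i : M →ₗ[R] L) (hi : Function.Injective i)
    (hcoker : δ R (L ⧸ LinearMap.range i) ≤ codim d 2) : Function.Surjective i :=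
  h.surjective_of_comap_range_eval_le hL LinearMap.id i hi hcoker fun _ _ => hM.2.2 _

/-- The finitely generated modules between `M` and `L` form a noetherian poset, because they embed
compatibly into the double dual of `M`. -/
theorem finite_of_extension [Module.Finite R M] (i : M →ₗ[R] L) (hi : Function.Injective i)
    (hL : IsTorsionFree δ (codim d 1) R L)
    (hcoker : δ R (L ⧸ LinearMap.range i) ≤ codim d 2) : Module.Finite R L := by
  have := h.noeth_left
  have := h.finite_doubleDual (M := M)
  let Between := {Y : Submodule R L // LinearMap.range i ≤ Y ∧ Y.FG}
  let incl (Y : Between) : M →ₗ[R] Y.1 := i.codRestrict Y.1 fun m => Y.2.1 ⟨m, rfl⟩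
  let hull (Y : Between) : Submodule R (DoubleDual R S D M) :=
    (LinearMap.range (eval R S D Y.1)).comap (DoubleDual.map (incl Y))
  have hull_mono : Monotone hull := by
    rintro Y Z hYZ F ⟨y, hy⟩
    exact ⟨Submodule.inclusion hYZ y, DoubleDual.ext fun ψ =>
      congrArg (fun G => G.toHom (ψ ∘ₗ Submodule.inclusion hYZ)) hy⟩
  have le_of_hull_le (Y Z : Between) (hYZ : Y ≤ Z) (hZY : hull Z ≤ hull Y) : Z ≤ Y := by
    have : Module.Finite R Z.1 := Module.Finite.iff_fg.2 Z.2.2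
    intro z hz
    obtain ⟨y, hy⟩ := h.surjective_of_comap_range_eval_le
      (hL.of_injective h.exact _ Z.1.injective_subtype) (incl Y) (Submodule.inclusion hYZ)
      (fun m m' hm => hi (congrArg Subtype.val hm))
      ((h.exact.coker_codRestrict_le i Z.1 _).trans hcoker) hZY ⟨z, hz⟩
    have hyz : (y : L) = z := congrArg Subtype.val hy
    exact hyz ▸ y.2
  obtain ⟨Y, -, hY⟩ := exists_maximalFor_of_wellFoundedGT (fun _ => True) hull
    ⟨⟨LinearMap.range i, le_rfl, Module.Finite.iff_fg.1 inferInstance⟩, trivial⟩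
  have hY_top : Y.1 = ⊤ := Submodule.eq_top_iff'.2 fun l => by
    let Z : Between := ⟨Y.1 ⊔ Submodule.span R {l}, Y.2.1.trans le_sup_left,
      Y.2.2.sup (Submodule.fg_span_singleton l)⟩
    have hYZ : Y ≤ Z := le_sup_left (a := Y.1)
    exact le_of_hull_le Y Z hYZ (hY trivial (hull_mono hYZ))
      (Submodule.mem_sup_right (Submodule.mem_span_singleton_self l))
  exact ⟨hY_top ▸ Y.2.2⟩

end DimFunction.IsDualizing

/-! ### Reflexive hulls of bimodules

A bimodule is treated here as a module over two rings `R` and `Q` with commuting actions. -/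

section Stable

variable {R Q M : Type u} [Ring R] [Ring Q] [AddCommGroup M] [Module R M] [Module Q M]

/-- A `Q`-submodule that is stable under `R`, as an `R`-module. -/
abbrev moduleOfStable (W : Submodule Q M) (hW : ∀ (r : R), ∀ m ∈ W, r • m ∈ W) :
    Module R W where
  smul r x := ⟨r • x.1, hW r x.1 x.2⟩
  one_smul x := Subtype.ext (one_smul R x.1)
  mul_smul r s x := Subtype.ext (mul_smul r s x.1)
  smul_zero r := Subtype.ext (smul_zero r)
  smul_add r x y := Subtype.ext (smul_add r x.1 y.1)
  add_smul r s x := Subtype.ext (add_smul r s x.1)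
  zero_smul x := Subtype.ext (zero_smul R x.1)

/-- The quotient by an `R`-stable `Q`-submodule, as an `R`-module. -/
abbrev quotientModuleOfStable [SMulCommClass R Q M] (W : Submodule Q M)
    (hW : ∀ (r : R), ∀ m ∈ W, r • m ∈ W) : Module R (M ⧸ W) where
  smul r := W.mapQ W (DistribSMul.toLinearMap Q M r) (hW r)
  one_smul x := by
    obtain ⟨x, rfl⟩ := Submodule.Quotient.mk_surjective _ x
    exact congrArg Submodule.Quotient.mk (one_smul R x)
  mul_smul r s x := by
    obtain ⟨x, rfl⟩ := Submodule.Quotient.mk_surjective _ x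
    exact congrArg Submodule.Quotient.mk (mul_smul r s x)
  smul_zero r := map_zero (W.mapQ W (DistribSMul.toLinearMap Q M r) (hW r))
  smul_add r := map_add (W.mapQ W (DistribSMul.toLinearMap Q M r) (hW r))
  add_smul r s x := by
    obtain ⟨x, rfl⟩ := Submodule.Quotient.mk_surjective _ x
    exact congrArg Submodule.Quotient.mk (add_smul r s x)
  zero_smul x := by
    obtain ⟨x, rfl⟩ := Submodule.Quotient.mk_surjective _ x
    exact congrArg Submodule.Quotient.mk (zero_smul R x)

end Stable

namespace DimFunction

/-- The unbundled form of the symmetry condition: `c : k` acts on central bimodules through both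
`κR c` and `κQ c`. -/
def IsSymmetricPair (δ : DimFunction.{u}) {k : Type v} {R Q : Type u} [Ring R] [Ring Q]
    (κR : k → R) (κQ : k → Q) : Prop :=
  ∀ (M : Type u) [AddCommGroup M] [Module R M] [Module Q M] [SMulCommClass Q R M],
    (∀ (c : k) (m : M), κR c • m = κQ c • m) →
      (Module.Finite R M → δ Q M ≤ δ R M) ∧ (Module.Finite Q M → δ R M ≤ δ Q M)

theorem IsSymmetricPair.symm {δ : DimFunction.{u}} {k : Type v} {R Q : Type u} [Ring R] [Ring Q]
    {κR : k → R} {κQ : k → Q} (hs : δ.IsSymmetricPair κR κQ) : δ.IsSymmetricPair κQ κR := by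
  intro M _ _ _ _ hM
  have : SMulCommClass Q R M := SMulCommClass.symm _ _ _
  exact (hs M fun c m => (hM c m).symm).symm

section Torsion

variable {δ : DimFunction.{u}} {k : Type v} {R Q : Type u} [Ring R] [Ring Q]
    {κR : k → R} {κQ : k → Q}
variable {M : Type u} [AddCommGroup M] [Module R M] [Module Q M] [SMulCommClass Q R M]
  {e : EReal}

theorem smul_mem_torsion (hQ : δ.IsExact Q) (r : R) (m : M) (hm : m ∈ torsion δ e Q M) :
    r • m ∈ torsion δ e Q M := by
  have : SMulCommClass R Q M := SMulCommClass.symm _ _ _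
  exact hQ.map_mem_torsion (DistribSMul.toLinearMap Q M r) hm

theorem isTorsionFree_of_stable (hR : δ.IsExact R) (hQ : δ.IsExact Q) {e' : EReal}
    (hM : IsTorsionFree δ e R M)
    (hle : letI := moduleOfStable (torsion δ e' Q M) (smul_mem_torsion (R := R) hQ)
      δ R (torsion δ e' Q M) ≤ e) : IsTorsionFree δ e' Q M := by
  let := moduleOfStable (torsion δ e' Q M) (smul_mem_torsion (R := R) hQ)
  let f : torsion δ e' Q M →ₗ[R] M :=
    { toFun := Subtype.val, map_add' := fun _ _ => rfl, map_smul' := fun _ _ => rfl }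
  have hf := hM (LinearMap.range f) ((hR.range_le f).trans hle)
  refine isTorsionFree_of_torsion_eq_bot (eq_bot_iff.2 fun x hx => ?_)
  have : x ∈ LinearMap.range f := ⟨⟨x, hx⟩, rfl⟩
  rw [hf] at this
  exact this

theorem IsSymmetricPair.isTorsionFree (hs : δ.IsSymmetricPair κR κQ) (hR : δ.IsExact R)
    (hQ : δ.IsExact Q) [IsNoetherianRing Q] [Module.Finite Q M]
    (hk : ∀ (c : k) (m : M), κR c • m = κQ c • m)
    (hM : IsTorsionFree δ e R M) : IsTorsionFree δ e Q M := by
  refine isTorsionFree_of_stable hR hQ hM ?_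
  let := moduleOfStable (torsion δ e Q M) (smul_mem_torsion (R := R) hQ)
  have : SMulCommClass Q R (torsion δ e Q M) :=
    ⟨fun q r x => Subtype.ext (smul_comm q r x.1)⟩
  exact ((hs (torsion δ e Q M) fun c x => Subtype.ext (hk c x.1)).2 inferInstance).trans
    hQ.torsion_le

variable {T : Type u} [AddCommGroup T] [Module R T] [Module Q T]

theorem IsSymmetricPair.dim_coker_le (hs : δ.IsSymmetricPair κR κQ) (hQ : δ.IsExact Q)
    [Module.Finite R M] (hk : ∀ (c : k) (m : M), κR c • m = κQ c • m)
    (i : T →ₗ[R] M) (j : T →ₗ[Q] M) (hij : ∀ t, i t = j t)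
    (hcoker : δ R (M ⧸ LinearMap.range i) ≤ e) : δ Q (M ⧸ LinearMap.range j) ≤ e := by
  have hst : ∀ (q : Q), ∀ m ∈ LinearMap.range i, q • m ∈ LinearMap.range i := by
    rintro q _ ⟨t, rfl⟩
    exact ⟨q • t, by rw [hij, hij, map_smul]⟩
  let := quotientModuleOfStable (R := Q) (LinearMap.range i) hst
  have : SMulCommClass Q R (M ⧸ LinearMap.range i) := ⟨fun q r x => by
    obtain ⟨x, rfl⟩ := Submodule.Quotient.mk_surjective _ x
    exact congrArg Submodule.Quotient.mk (smul_comm q r x)⟩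
  have hle : δ Q (M ⧸ LinearMap.range i) ≤ e := by
    refine le_trans ((hs (M ⧸ LinearMap.range i) fun c x => ?_).1 inferInstance) hcoker
    obtain ⟨x, rfl⟩ := Submodule.Quotient.mk_surjective _ x
    exact congrArg Submodule.Quotient.mk (hk c x)
  let p : M →ₗ[Q] (M ⧸ LinearMap.range i) :=
    { toFun := Submodule.Quotient.mk, map_add' := fun _ _ => rfl, map_smul' := fun _ _ => rfl }
  have hp : LinearMap.ker p ≤ LinearMap.range j := by
    intro x hx
    obtain ⟨t, rfl⟩ := (Submodule.Quotient.mk_eq_zero _).1 hx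
    exact ⟨t, (hij t).symm⟩
  refine (hQ.le_range_of_ker_le (LinearMap.range j).mkQ (Submodule.mkQ_surjective _) p ?_).trans
    ((hQ.submodule_le _).trans hle)
  rwa [Submodule.ker_mkQ]

theorem isTorsionFree_of_extension (hR : δ.IsExact R) (hQ : δ.IsExact Q)
    (hM : IsTorsionFree δ e R M) {e' : EReal} (hT : IsTorsionFree δ e' Q T)
    (i : T →ₗ[R] M) (j : T →ₗ[Q] M) (hij : ∀ t, i t = j t) (hj : Function.Injective j)
    (hcoker : δ R (M ⧸ LinearMap.range i) ≤ e) : IsTorsionFree δ e' Q M := by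
  refine isTorsionFree_of_stable hR hQ hM ?_
  let := moduleOfStable (torsion δ e' Q M) (smul_mem_torsion (R := R) hQ)
  let f : torsion δ e' Q M →ₗ[R] M :=
    { toFun := Subtype.val, map_add' := fun _ _ => rfl, map_smul' := fun _ _ => rfl }
  refine (hR.le_of_injective ((LinearMap.range i).mkQ ∘ₗ f) ?_).trans hcoker
  rw [← LinearMap.ker_eq_bot, eq_bot_iff]
  rintro ⟨x, hx⟩ hx'
  obtain ⟨t, rfl⟩ : x ∈ LinearMap.range i := (Submodule.Quotient.mk_eq_zero _).1 hx'
  have hcomap : (torsion δ e' Q M).comap j = ⊥ := by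
    refine hT _ (le_trans ?_ (hQ.torsion_le (M := M) (e := e')))
    refine hQ.le_of_injective ((j ∘ₗ ((torsion δ e' Q M).comap j).subtype).codRestrict _
      fun x => x.2) fun x y hxy => ?_
    exact Subtype.ext (hj (congrArg Subtype.val hxy))
  have ht : t ∈ (torsion δ e' Q M).comap j := by
    rw [Submodule.mem_comap, ← hij]
    exact hx
  rw [hcomap, Submodule.mem_bot] at ht
  subst ht
  exact Subtype.ext (map_zero i)

end Torsion

end DimFunction

namespace DoubleDual

/-- The natural map to the double dual, as a linear map for a commuting action. -/
def evalAction (R S D M Q : Type u) [Ring R] [Ring S] [AddCommGroup D] [Module R D] [Module S D]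
    [SMulCommClass R S D] [SMulCommClass S R D] [AddCommGroup M] [Module R M] [Ring Q] [Module Q M]
    [SMulCommClass Q R M] : M →ₗ[Q] DoubleDual R S D M where
  toFun := eval R S D M
  map_add' := map_add _
  map_smul' _ _ := rfl

end DoubleDual

namespace DimFunction.IsDualizing

open DoubleDual

variable {δ : DimFunction.{u}} {d : ℕ} {k : Type v} {R S D Q S' D' : Type u} [Ring R] [Ring S]
    [AddCommGroup D] [Module R D] [Module S D] [SMulCommClass R S D] [SMulCommClass S R D]
    [Ring Q] [Ring S']
    [AddCommGroup D'] [Module Q D'] [Module S' D'] [SMulCommClass Q S' D'] [SMulCommClass S' Q D']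
    {κR : k → R} {κS : k → S} {κQ : k → Q} {κS' : k → S'}
variable {T : Type u} [AddCommGroup T] [Module R T] [Module Q T] [SMulCommClass Q R T]

theorem central_doubleDual (hD : ∀ c (x : D), κR c • x = κS c • x)
    (hk : ∀ (c : k) (t : T), κR c • t = κQ c • t) (c : k) (F : DoubleDual R S D T) :
    κR c • F = κQ c • F := DoubleDual.ext fun φ =>
  calc κR c • F.toHom φ = F.toHom (κS c • φ) := by rw [hD, map_smul]
    _ = F.toHom (φ ∘ₗ DistribSMul.toLinearMap R T (κQ c)) :=
      congrArg F.toHom <| LinearMap.ext fun t => by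
        rw [LinearMap.smul_apply, ← hD, LinearMap.comp_apply, DistribSMul.toLinearMap_apply, ← hk,
          map_smul]

theorem dim_coker_evalAction_le (hR : δ.IsDualizing d R S D) (hQ : δ.IsExact Q)
    (hs : δ.IsSymmetricPair κR κQ) (hD : ∀ c (x : D), κR c • x = κS c • x)
    (hk : ∀ (c : k) (t : T), κR c • t = κQ c • t) [Module.Finite R T] :
    δ Q (DoubleDual R S D T ⧸ LinearMap.range (evalAction R S D T Q)) ≤ codim d 2 := by
  have := hR.finite_doubleDual (M := T)
  exact hs.dim_coker_le hQ (central_doubleDual hD hk) (eval R S D T) _ (fun _ => rfl)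
    hR.dim_coker_eval_le

theorem isTorsionFree_doubleDual_otherSide (hR : δ.IsDualizing d R S D) (hQ : δ.IsExact Q)
    [Module.Finite R T] (hTR : IsTorsionFree δ (codim d 1) R T)
    (hTQ : IsTorsionFree δ (codim d 1) Q T) :
    IsTorsionFree δ (codim d 1) Q (DoubleDual R S D T) :=
  isTorsionFree_of_extension hR.exact hQ hR.isTorsionFree_doubleDual hTQ (eval R S D T)
    (evalAction R S D T Q) (fun _ => rfl) (hR.eval_injective hTR)
    (hR.dim_coker_eval_le.trans ((codim_strictAnti d).antitone one_le_two))

variable (hR : δ.IsDualizing d R S D) (hQ : δ.IsDualizing d Q S' D')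
  (hs : δ.IsSymmetricPair κR κQ)

include hR hQ hs

theorem finite_doubleDual_otherSide (hD : ∀ c (x : D), κR c • x = κS c • x)
    (hk : ∀ (c : k) (t : T), κR c • t = κQ c • t)
    [Module.Finite R T] [Module.Finite Q T] (hTR : IsTorsionFree δ (codim d 1) R T)
    (hTQ : IsTorsionFree δ (codim d 1) Q T) : Module.Finite Q (DoubleDual R S D T) :=
  hQ.finite_of_extension (evalAction R S D T Q) (hR.eval_injective hTR)
    (hR.isTorsionFree_doubleDual_otherSide hQ.exact hTR hTQ)
    (hR.dim_coker_evalAction_le hQ.exact hs hD hk)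

/-- The double dual over `Q` of `T**` is an extension of `T**` of codimension two over `R`, where
`T**` is reflexive. -/
theorem isReflexiveModule_otherSide (hD : ∀ c (x : D), κR c • x = κS c • x)
    (hD' : ∀ c (x : D'), κQ c • x = κS' c • x)
    (hk : ∀ (c : k) (t : T), κR c • t = κQ c • t)
    [Module.Finite R T] [Module.Finite Q T] (hTR : IsTorsionFree δ (codim d 1) R T) :
    IsReflexiveModule Q S' D' (DoubleDual R S D T) := by
  have := hQ.noeth_left
  have hTQ := hs.isTorsionFree hR.exact hQ.exact hk hTR
  have := finite_doubleDual_otherSide hR hQ hs hD hk hTR hTQ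
  have htf := hR.isTorsionFree_doubleDual_otherSide hQ.exact hTR hTQ
  have : SMulCommClass R Q (DoubleDual R S D T) := SMulCommClass.symm _ _ _
  have hinj : Function.Injective (eval Q S' D' (DoubleDual R S D T)) := hQ.eval_injective htf
  have := hR.finite_doubleDual (M := T)
  have := finite_doubleDual_otherSide hQ hR hs.symm hD'
    (fun c F => (central_doubleDual hD hk c F).symm) htf hR.isTorsionFree_doubleDual
  exact ⟨‹_›, hinj, hR.surjective_of_isReflexiveModule hR.isReflexiveModule_doubleDual
    (hQ.isTorsionFree_doubleDual_otherSide hR.exact htf hR.isTorsionFree_doubleDual)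
    (evalAction Q S' D' (DoubleDual R S D T) R) hinj
    (hQ.dim_coker_evalAction_le hR.exact hs.symm hD' fun c F =>
      (central_doubleDual hD hk c F).symm)⟩

end DimFunction.IsDualizing

/-! ### Tensor products over noncommutative rings -/

namespace NCTensor

attribute [local instance] NCTensor.leftAction NCTensor.rightAction

section Lift

variable {R M N : Type u} [Ring R] [AddCommGroup M] [Module Rᵐᵒᵖ M] [AddCommGroup N] [Module R N]

theorem induction_on {p : NCTensor R M N → Prop} (x : NCTensor R M N)
    (tmul : ∀ m n, p (tmul R m n)) (add : ∀ x y, p x → p y → p (x + y)) : p x := by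
  obtain ⟨x, rfl⟩ := QuotientAddGroup.mk'_surjective _ x
  induction x using TensorProduct.induction_on with
  | zero =>
    have := tmul 0 0
    rwa [NCTensor.tmul, TensorProduct.zero_tmul, map_zero] at this
  | tmul m n => exact tmul m n
  | add x y hx hy =>
    rw [map_add]
    exact add _ _ hx hy

/-- The map induced by a balanced biadditive map. -/
noncomputable def lift {G : Type*} [AddCommGroup G] (f : M →+ N →+ G)
    (hf : ∀ (m : M) (r : R) (n : N), f (MulOpposite.op r • m) n = f m (r • n)) :
    NCTensor R M N →+ G :=
  QuotientAddGroup.lift (NCTensor.relations R M N)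
    (TensorProduct.liftAddHom f fun c m n => by
      rw [map_zsmul, map_zsmul, AddMonoidHom.zsmul_apply]) (by
    rw [NCTensor.relations, AddSubgroup.closure_le]
    rintro _ ⟨m, r, n, rfl⟩
    rw [SetLike.mem_coe, AddMonoidHom.mem_ker, map_sub, sub_eq_zero]
    exact hf m r n)

variable (R M N) in
/-- The universal balanced biadditive map `(m, n) ↦ m ⊗ n`. -/
noncomputable def tmulHom : M →+ N →+ NCTensor R M N :=
  AddMonoidHom.mk' (fun m => AddMonoidHom.mk' (tmul R m) (tmul_add m))
    fun m m' => AddMonoidHom.ext fun n => add_tmul m m' n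

theorem tmulHom_apply (m : M) (n : N) : tmulHom R M N m n = tmul R m n := rfl

theorem sum_tmul {ι : Type*} (s : Finset ι) (m : ι → M) (n : N) :
    tmul R (∑ i ∈ s, m i) n = ∑ i ∈ s, tmul R (m i) n := by
  rw [← tmulHom_apply, map_sum, AddMonoidHom.finsetSum_apply]
  rfl

theorem tmul_sum {ι : Type*} (s : Finset ι) (m : M) (n : ι → N) :
    tmul R m (∑ i ∈ s, n i) = ∑ i ∈ s, tmul R m (n i) :=
  map_sum (tmulHom R M N m) n s

end Lift

section RightExact

variable {R K M N P : Type u} [Ring R]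

/-- A map induced by `p` that is inverse to the cokernel of `j` exhibits `p` as this cokernel. -/
theorem exact_of_comp_eq_mk' {X Y Z : Type*} [AddCommGroup X] [AddCommGroup Y] [AddCommGroup Z]
    {j : X →+ Y} {p : Y →+ Z} (ψ : Z →+ Y ⧸ j.range)
    (hψ : ψ.comp p = QuotientAddGroup.mk' j.range) (hpj : p.comp j = 0) : Function.Exact j p := by
  refine fun y => ⟨fun hy => AddMonoidHom.mem_range.1 ((QuotientAddGroup.eq_zero_iff y).1 ?_), ?_⟩
  · exact (DFunLike.congr_fun hψ y).symm.trans ((congrArg ψ hy).trans (map_zero ψ))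
  · rintro ⟨x, rfl⟩
    exact DFunLike.congr_fun hpj x

theorem exact_map_left [AddCommGroup K] [Module Rᵐᵒᵖ K] [AddCommGroup M] [Module Rᵐᵒᵖ M]
    [AddCommGroup P] [Module Rᵐᵒᵖ P] [AddCommGroup N] [Module R N]
    {i : K →ₗ[Rᵐᵒᵖ] M} {f : M →ₗ[Rᵐᵒᵖ] P} (hif : Function.Exact i f)
    (hf : Function.Surjective f) :
    Function.Exact (map i (LinearMap.id : N →ₗ[R] N)) (map f (LinearMap.id : N →ₗ[R] N)) := by
  let mk := QuotientAddGroup.mk' (map i (LinearMap.id : N →ₗ[R] N)).range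
  let β : M →+ N →+ _ := (AddMonoidHom.compHom mk).comp (tmulHom R M N)
  have hβ : f.toAddMonoidHom.ker ≤ β.ker := by
    intro m hm
    obtain ⟨x, rfl⟩ := (hif m).1 hm
    exact AddMonoidHom.ext fun n => (QuotientAddGroup.eq_zero_iff _).2 ⟨tmul R x n, rfl⟩
  let φ : P →+ N →+ _ := f.toAddMonoidHom.liftOfSurjective hf ⟨β, hβ⟩
  have hφ (m : M) : φ (f m) = β m := f.toAddMonoidHom.liftOfRightInverse_comp_apply _ _ ⟨β, hβ⟩ m
  let ψ := lift φ fun p r n => by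
    obtain ⟨m, rfl⟩ := hf p
    rw [← map_smul, hφ, hφ]
    exact congrArg mk (smul_tmul r m n)
  refine exact_of_comp_eq_mk' ψ (addHom_ext fun m n => DFunLike.congr_fun (hφ m) n) ?_
  rw [← map_comp, hif.linearMap_comp_eq_zero, map_zero_left]

theorem exact_map_right [AddCommGroup K] [Module R K] [AddCommGroup N] [Module R N]
    [AddCommGroup P] [Module R P] [AddCommGroup M] [Module Rᵐᵒᵖ M]
    {i : K →ₗ[R] N} {f : N →ₗ[R] P} (hif : Function.Exact i f)
    (hf : Function.Surjective f) :
    Function.Exact (map (LinearMap.id : M →ₗ[Rᵐᵒᵖ] M) i)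
      (map (LinearMap.id : M →ₗ[Rᵐᵒᵖ] M) f) := by
  let mk := QuotientAddGroup.mk' (map (LinearMap.id : M →ₗ[Rᵐᵒᵖ] M) i).range
  let β : N →+ M →+ _ := ((AddMonoidHom.compHom mk).comp (tmulHom R M N)).flip
  have hβ : f.toAddMonoidHom.ker ≤ β.ker := by
    intro n hn
    obtain ⟨x, rfl⟩ := (hif n).1 hn
    exact AddMonoidHom.ext fun m => (QuotientAddGroup.eq_zero_iff _).2 ⟨tmul R m x, rfl⟩
  let φ : P →+ M →+ _ := f.toAddMonoidHom.liftOfSurjective hf ⟨β, hβ⟩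
  have hφ (n : N) : φ (f n) = β n := f.toAddMonoidHom.liftOfRightInverse_comp_apply _ _ ⟨β, hβ⟩ n
  let ψ := lift φ.flip fun m r p => by
    obtain ⟨n, rfl⟩ := hf p
    rw [AddMonoidHom.flip_apply, AddMonoidHom.flip_apply, ← map_smul, hφ, hφ]
    exact congrArg mk (smul_tmul r m n)
  refine exact_of_comp_eq_mk' ψ (addHom_ext fun m n => DFunLike.congr_fun (hφ n) m) ?_
  rw [← map_comp, hif.linearMap_comp_eq_zero, map_zero_right]

theorem map_surjective {M' N' : Type u} [AddCommGroup M] [Module Rᵐᵒᵖ M] [AddCommGroup M']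
    [Module Rᵐᵒᵖ M'] [AddCommGroup N] [Module R N] [AddCommGroup N'] [Module R N']
    {f : M →ₗ[Rᵐᵒᵖ] M'} {g : N →ₗ[R] N'} (hf : Function.Surjective f)
    (hg : Function.Surjective g) : Function.Surjective (map f g) := by
  intro x
  induction x using induction_on with
  | tmul m n =>
    obtain ⟨m, rfl⟩ := hf m
    obtain ⟨n, rfl⟩ := hg n
    exact ⟨tmul R m n, rfl⟩
  | add x y hx hy =>
    obtain ⟨x, rfl⟩ := hx
    obtain ⟨y, rfl⟩ := hy
    exact ⟨x + y, map_add _ _ _⟩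

end RightExact

section Linear

variable {R Q : Type u} [Ring R] [Ring Q] {M M' N N' : Type u} [AddCommGroup M] [Module Rᵐᵒᵖ M]
  [AddCommGroup M'] [Module Rᵐᵒᵖ M'] [AddCommGroup N] [Module R N] [Module Q N]
  [SMulCommClass Q R N] [AddCommGroup N'] [Module R N'] [Module Q N'] [SMulCommClass Q R N']

theorem smul_tmul_right (q : Q) (m : M) (n : N) : q • tmul R m n = tmul R m (q • n) := rfl

theorem linearMap_ext {G : Type*} [AddCommGroup G] [Module Q G] {φ ψ : NCTensor R M N →ₗ[Q] G}
    (h : ∀ m n, φ (tmul R m n) = ψ (tmul R m n)) : φ = ψ :=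
  LinearMap.toAddMonoidHom_injective (addHom_ext h)

/-- The tensor product of two maps, linear for an action on the right factors. -/
def mapLinear (f : M →ₗ[Rᵐᵒᵖ] M') (g : N →ₗ[R] N') (hg : ∀ (q : Q) (n : N), g (q • n) = q • g n) :
    NCTensor R M N →ₗ[Q] NCTensor R M' N' where
  toFun := map f g
  map_add' := map_add (map f g)
  map_smul' q x := by
    induction x using induction_on with
    | tmul m n => exact congrArg (tmul R (f m)) (hg q n)
    | add x y hx hy => rw [smul_add, map_add, hx, hy, map_add, smul_add]

variable (Q N) in
/-- The functoriality of the tensor product in the left factor. -/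
def rTensor (f : M →ₗ[Rᵐᵒᵖ] M') : NCTensor R M N →ₗ[Q] NCTensor R M' N :=
  mapLinear f LinearMap.id fun _ _ => rfl

variable (M) in
/-- The functoriality of the tensor product in the right factor. -/
def lTensor (g : N →ₗ[R] N') (hg : ∀ (q : Q) (n : N), g (q • n) = q • g n) :
    NCTensor R M N →ₗ[Q] NCTensor R M N' :=
  mapLinear LinearMap.id g hg

theorem lTensor_rTensor (f : M →ₗ[Rᵐᵒᵖ] M') (g : N →ₗ[R] N')
    (hg : ∀ (q : Q) (n : N), g (q • n) = q • g n) (t : NCTensor R M N) :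
    rTensor Q N' f (lTensor M g hg t) = lTensor M' g hg (rTensor Q N f t) :=
  DFunLike.congr_fun (linearMap_ext (φ := rTensor Q N' f ∘ₗ lTensor M g hg)
    (ψ := lTensor M' g hg ∘ₗ rTensor Q N f) fun _ _ => rfl) t

variable (Q N) in
/-- The map `(aᵢ) ↦ ∑ i, xᵢ ⊗ aᵢ` for a family `x` in the left factor. -/
def sumTmul {n : ℕ} (x : Fin n → M) : (Fin n → N) →ₗ[Q] NCTensor R M N where
  toFun a := ∑ i, tmul R (x i) (a i)
  map_add' a b := by simp only [Pi.add_apply, tmul_add, Finset.sum_add_distrib]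
  map_smul' q a := by simp only [Pi.smul_apply, Finset.smul_sum, smul_tmul_right, RingHom.id_apply]

theorem sumTmul_apply {n : ℕ} (x : Fin n → M) (a : Fin n → N) :
    sumTmul (R := R) Q N x a = ∑ i, tmul R (x i) (a i) := rfl

theorem sumTmul_surjective {n : ℕ} {x : Fin n → M}
    (hx : Submodule.span Rᵐᵒᵖ (Set.range x) = ⊤) :
    Function.Surjective (sumTmul (R := R) Q N x) := by
  intro t
  induction t using induction_on with
  | tmul m a =>
    obtain ⟨c, rfl⟩ := (Submodule.mem_span_range_iff_exists_fun Rᵐᵒᵖ).1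
      (hx ▸ Submodule.mem_top : m ∈ Submodule.span Rᵐᵒᵖ (Set.range x))
    refine ⟨fun i => (c i).unop • a, ?_⟩
    rw [sumTmul_apply, sum_tmul]
    exact Finset.sum_congr rfl fun i _ => (smul_tmul (c i).unop (x i) a).symm
  | add s t hs ht =>
    obtain ⟨a, rfl⟩ := hs
    obtain ⟨b, rfl⟩ := ht
    exact ⟨a + b, map_add _ _ _⟩

theorem finite_right [Module.Finite Rᵐᵒᵖ M] [Module.Finite Q N] :
    Module.Finite Q (NCTensor R M N) := by
  obtain ⟨n, x, hx⟩ := Module.Finite.exists_fin (R := Rᵐᵒᵖ) (M := M)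
  exact Module.Finite.of_surjective _ (sumTmul_surjective (Q := Q) (N := N) hx)

theorem dim_le_right {δ : DimFunction.{u}} (h : δ.IsExact Q) {e : EReal} [Module.Finite Rᵐᵒᵖ M]
    (hN : δ Q N ≤ e) : δ Q (NCTensor R M N) ≤ e := by
  obtain ⟨n, x, hx⟩ := Module.Finite.exists_fin (R := Rᵐᵒᵖ) (M := M)
  exact (h.le_of_surjective _ (sumTmul_surjective (Q := Q) (N := N) hx)).trans (h.pi_le hN n)

end Linear

section LeftFactor

variable {R Q : Type u} [Ring R] [Ring Q] {M N : Type u} [AddCommGroup M] [Module Rᵐᵒᵖ M]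
  [Module Q M] [SMulCommClass Q Rᵐᵒᵖ M] [AddCommGroup N] [Module R N]

variable (Q M) in
/-- The map `(aᵢ) ↦ ∑ i, aᵢ ⊗ yᵢ` for a family `y` in the right factor. -/
def tmulSum {n : ℕ} (y : Fin n → N) : (Fin n → M) →ₗ[Q] NCTensor R M N where
  toFun a := ∑ i, tmul R (a i) (y i)
  map_add' a b := by simp only [Pi.add_apply, add_tmul, Finset.sum_add_distrib]
  map_smul' q a := by
    rw [Finset.smul_sum]
    rfl

theorem tmulSum_apply {n : ℕ} (y : Fin n → N) (a : Fin n → M) :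
    tmulSum (R := R) Q M y a = ∑ i, tmul R (a i) (y i) := rfl

theorem tmulSum_surjective {n : ℕ} {y : Fin n → N} (hy : Submodule.span R (Set.range y) = ⊤) :
    Function.Surjective (tmulSum (R := R) Q M y) := by
  intro t
  induction t using induction_on with
  | tmul m x =>
    obtain ⟨c, rfl⟩ := (Submodule.mem_span_range_iff_exists_fun R).1
      (hy ▸ Submodule.mem_top : x ∈ Submodule.span R (Set.range y))
    refine ⟨fun i => MulOpposite.op (c i) • m, ?_⟩
    rw [tmulSum_apply, tmul_sum]
    exact Finset.sum_congr rfl fun i _ => smul_tmul (c i) m (y i)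
  | add s t hs ht =>
    obtain ⟨a, rfl⟩ := hs
    obtain ⟨b, rfl⟩ := ht
    exact ⟨a + b, map_add _ _ _⟩

theorem dim_le_left {δ : DimFunction.{u}} (h : δ.IsExact Q) {e : EReal} [Module.Finite R N]
    (hM : δ Q M ≤ e) : δ Q (NCTensor R M N) ≤ e := by
  obtain ⟨n, y, hy⟩ := Module.Finite.exists_fin (R := R) (M := N)
  exact (h.le_of_surjective _ (tmulSum_surjective (Q := Q) (M := M) hy)).trans (h.pi_le hM n)

end LeftFactor

end NCTensor

/-! ### Kernels and cokernels of tensored maps -/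

namespace DimFunction.IsExact

variable {δ : DimFunction.{u}} {R : Type u} [Ring R] (h : δ.IsExact R) {e : EReal}
variable {X X' Y Y' Z Z' : Type u} [AddCommGroup X] [Module R X] [AddCommGroup X'] [Module R X']
  [AddCommGroup Y] [Module R Y] [AddCommGroup Y'] [Module R Y'] [AddCommGroup Z] [Module R Z]
  [AddCommGroup Z'] [Module R Z']

include h

theorem ker_le_of_injective (f : X →ₗ[R] Y) (hf : Function.Injective f) :
    δ R (LinearMap.ker f) ≤ e := by
  have : Subsingleton (LinearMap.ker f) := by
    rw [LinearMap.ker_eq_bot.2 hf]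
    infer_instance
  exact h.le_of_subsingleton

theorem coker_le_of_surjective (f : X →ₗ[R] Y) (hf : Function.Surjective f) :
    δ R (Y ⧸ LinearMap.range f) ≤ e := by
  have : Subsingleton (Y ⧸ LinearMap.range f) :=
    Submodule.Quotient.subsingleton_iff.2 (LinearMap.range_eq_top.2 hf)
  exact h.le_of_subsingleton

theorem ker_le_of_square {f : X →ₗ[R] Y} {f' : X' →ₗ[R] Y'} (a : X →ₗ[R] X') (b : Y →ₗ[R] Y')
    (hab : ∀ x, f' (a x) = b (f x)) (ha : δ R (X' ⧸ LinearMap.range a) ≤ e)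
    (hb : δ R (LinearMap.ker b) ≤ e) (hf : δ R (LinearMap.ker f) ≤ e) :
    δ R (LinearMap.ker f') ≤ e := by
  refine h.ker_le_of_comp_of_coker a f' ha ?_
  rw [show f' ∘ₗ a = b ∘ₗ f from LinearMap.ext hab]
  exact h.ker_comp_le f b hf hb

theorem ker_le_of_square' {f : X →ₗ[R] Y} {f' : X' →ₗ[R] Y'} (a : X →ₗ[R] X') (b : Y →ₗ[R] Y')
    (hab : ∀ x, f' (a x) = b (f x)) (ha : δ R (LinearMap.ker a) ≤ e)
    (hf' : δ R (LinearMap.ker f') ≤ e) : δ R (LinearMap.ker f) ≤ e := by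
  refine h.ker_le_of_comp f b ?_
  rw [← show f' ∘ₗ a = b ∘ₗ f from LinearMap.ext hab]
  exact h.ker_comp_le a f' ha hf'

theorem coker_le_of_exact {i : X →ₗ[R] Y} {p : Y →ₗ[R] Z} (hip : Function.Exact i p) :
    δ R (Y ⧸ LinearMap.range i) ≤ δ R Z := by
  refine (h.le_range_of_ker_le _ (Submodule.mkQ_surjective _) p ?_).trans (h.submodule_le _)
  rw [Submodule.ker_mkQ, hip.linearMap_ker_eq]

theorem ker_le_of_exact_rows {i : X →ₗ[R] Y} {p : Y →ₗ[R] Z} {i' : X' →ₗ[R] Y'} {p' : Y' →ₗ[R] Z'}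
    {a : X →ₗ[R] X'} {b : Y →ₗ[R] Y'} {c : Z →ₗ[R] Z'} (hip : Function.Exact i p)
    (hp : Function.Surjective p) (hip' : Function.Exact i' p') (hia : ∀ x, i' (a x) = b (i x))
    (hpb : ∀ y, p' (b y) = c (p y)) (ha : δ R (X' ⧸ LinearMap.range a) ≤ e)
    (hb : δ R (LinearMap.ker b) ≤ e) : δ R (LinearMap.ker c) ≤ e := by
  -- `c` factors through the cokernel of `b ∘ i`.
  set mk := (LinearMap.range (b ∘ₗ i)).mkQ
  have hmk (x : X) : mk (b (i x)) = 0 := (Submodule.Quotient.mk_eq_zero _).2 ⟨x, rfl⟩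
  let c₁ : Z →ₗ[R] Y' ⧸ LinearMap.range (b ∘ₗ i) :=
    (LinearMap.ker p).liftQ (mk ∘ₗ b) (by
      rw [hip.linearMap_ker_eq]
      rintro _ ⟨x, rfl⟩
      exact hmk x) ∘ₗ (p.quotKerEquivOfSurjective hp).symm
  have hc₁ (y : Y) : c₁ (p y) = mk (b y) :=
    congrArg _ (p.quotKerEquivOfSurjective_symm_apply hp y)
  let c₂ : Y' ⧸ LinearMap.range (b ∘ₗ i) →ₗ[R] Z' := Submodule.liftQ _ p' (by
    rintro _ ⟨x, rfl⟩
    exact (congrArg p' (hia x)).symm.trans (hip'.apply_apply_eq_zero _))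
  have hc : c = c₂ ∘ₗ c₁ := by
    ext z
    obtain ⟨y, rfl⟩ := hp z
    rw [LinearMap.comp_apply, hc₁, ← hpb]
    rfl
  have hker₁ : LinearMap.ker c₁ ≤ (LinearMap.ker b).map p := by
    intro z hz
    obtain ⟨y, rfl⟩ := hp z
    rw [LinearMap.mem_ker, hc₁] at hz
    obtain ⟨x, hx⟩ : b y ∈ LinearMap.range (b ∘ₗ i) := (Submodule.Quotient.mk_eq_zero _).1 hz
    refine ⟨y - i x, ?_, by rw [map_sub, hip.apply_apply_eq_zero, sub_zero]⟩
    exact LinearMap.mem_ker.2 ((map_sub _ _ _).trans (sub_eq_zero.2 hx.symm))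
  have hker₂ : LinearMap.ker c₂ ≤ LinearMap.range (Submodule.liftQ (LinearMap.range a)
      (mk ∘ₗ i') (by rintro _ ⟨x, rfl⟩; exact (congrArg mk (hia x)).trans (hmk x))) := by
    intro y hy
    obtain ⟨y, rfl⟩ := Submodule.mkQ_surjective _ y
    obtain ⟨x, rfl⟩ := (hip' y).1 hy
    exact ⟨Submodule.Quotient.mk x, rfl⟩
  rw [hc]
  exact h.ker_comp_le c₁ c₂ ((h.submodule_mono hker₁).trans ((h.map_le p _).trans hb))
    ((h.submodule_mono hker₂).trans ((h.range_le _).trans ha))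

end DimFunction.IsExact

namespace NCTensor

attribute [local instance] NCTensor.leftAction NCTensor.rightAction

section Dimension

variable {R Q : Type u} [Ring R] [Ring Q] {M N N' : Type u} [AddCommGroup M] [Module Rᵐᵒᵖ M]
  [AddCommGroup N] [Module R N] [Module Q N] [SMulCommClass Q R N] [AddCommGroup N'] [Module R N']
  [Module Q N'] [SMulCommClass Q R N'] {δ : DimFunction.{u}} (h : δ.IsExact Q) {e : EReal}

variable (R Q N) in
theorem sumTmul_single_bijective (n : ℕ) : Function.Bijective
    (sumTmul (R := R) Q N fun i : Fin n => (Pi.single i 1 : Fin n → Rᵐᵒᵖ)) := by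
  let ψ : NCTensor R (Fin n → Rᵐᵒᵖ) N →+ (Fin n → N) :=
    lift (AddMonoidHom.mk' (fun c => AddMonoidHom.mk' (fun a i => (c i).unop • a)
      fun a b => funext fun i => smul_add _ a b)
      fun c c' => AddMonoidHom.ext fun a => funext fun i => add_smul (c i).unop (c' i).unop a)
      fun c r a => funext fun i => mul_smul (c i).unop r a
  refine ⟨Function.LeftInverse.injective (g := ψ) fun a => ?_, sumTmul_surjective ?_⟩
  · have hψ (i : Fin n) : ψ (tmul R (Pi.single i 1) (a i)) = Pi.single i (a i) := by
      ext j
      change MulOpposite.unop ((Pi.single i 1 : Fin n → Rᵐᵒᵖ) j) • a i = _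
      obtain rfl | hij := eq_or_ne j i
      · rw [Pi.single_eq_same, Pi.single_eq_same, MulOpposite.unop_one, one_smul]
      · rw [Pi.single_eq_of_ne hij, Pi.single_eq_of_ne hij, MulOpposite.unop_zero, zero_smul]
    rw [sumTmul_apply, map_sum, Finset.sum_congr rfl fun i _ => hψ i, Finset.univ_sum_single]
  · rw [← (Pi.basisFun Rᵐᵒᵖ (Fin n)).span_eq]
    exact congrArg (fun x => Submodule.span Rᵐᵒᵖ (Set.range x))
      (funext fun i => (Pi.basisFun_apply Rᵐᵒᵖ (Fin n) i).symm)

include h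

theorem dim_coker_lTensor_le_of_exact [Module.Finite Rᵐᵒᵖ M] {C : Type u} [AddCommGroup C]
    [Module R C] [Module Q C] [SMulCommClass Q R C] {f : N →ₗ[R] N'}
    (hf : ∀ (q : Q) (n : N), f (q • n) = q • f n) {p : N' →ₗ[R] C}
    (hp : ∀ (q : Q) (n : N'), p (q • n) = q • p n) (hfp : Function.Exact f p)
    (hps : Function.Surjective p) (hC : δ Q C ≤ e) :
    δ Q (NCTensor R M N' ⧸ LinearMap.range (lTensor (Q := Q) M f hf)) ≤ e :=
  (h.coker_le_of_exact (p := lTensor M p hp) (exact_map_right hfp hps)).trans (dim_le_right h hC)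

variable (M) in
theorem dim_coker_lTensor_le [Module.Finite Rᵐᵒᵖ M] (f : N →ₗ[R] N') (g : N →ₗ[Q] N')
    (hfg : ∀ n, f n = g n) (hc : δ Q (N' ⧸ LinearMap.range g) ≤ e) :
    δ Q (NCTensor R M N' ⧸
      LinearMap.range (lTensor (Q := Q) M f fun q n => by rw [hfg, hfg, map_smul])) ≤ e := by
  have : SMulCommClass R Q N' := SMulCommClass.symm _ _ _
  have hst : ∀ (r : R), ∀ m ∈ LinearMap.range g, r • m ∈ LinearMap.range g := by
    rintro r _ ⟨a, rfl⟩
    exact ⟨r • a, by rw [← hfg, ← hfg, map_smul]⟩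
  let := quotientModuleOfStable (LinearMap.range g) hst
  have : SMulCommClass Q R (N' ⧸ LinearMap.range g) := ⟨fun q r x => by
    obtain ⟨x, rfl⟩ := Submodule.Quotient.mk_surjective _ x
    exact congrArg Submodule.Quotient.mk (smul_comm q r x)⟩
  let p : N' →ₗ[R] (N' ⧸ LinearMap.range g) :=
    { toFun := Submodule.Quotient.mk, map_add' := fun _ _ => rfl, map_smul' := fun _ _ => rfl }
  have hfp : Function.Exact f p := fun a =>
    (Submodule.Quotient.mk_eq_zero _).trans
      ⟨fun ⟨y, hy⟩ => ⟨y, (hfg y).trans hy⟩, fun ⟨y, hy⟩ => ⟨y, (hfg y).symm.trans hy⟩⟩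
  have hps : Function.Surjective p := fun x => by
    obtain ⟨x, rfl⟩ := Submodule.Quotient.mk_surjective _ x
    exact ⟨x, rfl⟩
  exact dim_coker_lTensor_le_of_exact h _ (p := p) (fun _ _ => rfl) hfp hps hc

theorem dim_ker_lTensor_pi_le (n : ℕ) (f : N →ₗ[R] N') (g : N →ₗ[Q] N') (hfg : ∀ n, f n = g n)
    (hk : δ Q (LinearMap.ker g) ≤ e) :
    δ Q (LinearMap.ker (lTensor (Q := Q) (Fin n → Rᵐᵒᵖ) f
      fun q n => by rw [hfg, hfg, map_smul])) ≤ e := by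
  refine h.ker_le_of_square (f := g.compLeft (Fin n)) (sumTmul (R := R) Q N _) (sumTmul Q N' _)
    (fun a => ?_) (h.coker_le_of_surjective _ (sumTmul_single_bijective R Q N n).2)
    (h.ker_le_of_injective _ (sumTmul_single_bijective R Q N' n).1) ?_
  · rw [sumTmul_apply, map_sum, sumTmul_apply]
    exact Finset.sum_congr rfl fun i _ => congrArg (tmul R _) (hfg (a i))
  · refine (h.le_of_injective (LinearMap.pi fun i =>
      (LinearMap.proj i ∘ₗ (LinearMap.ker (g.compLeft (Fin n))).subtype).codRestrict
        (LinearMap.ker g) fun a => congrFun a.2 i) ?_).trans (h.pi_le hk n)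
    exact fun a b hab => Subtype.ext (funext fun i => congrArg Subtype.val (congrFun hab i))

theorem dim_ker_lTensor_le [IsNoetherianRing Rᵐᵒᵖ] [Module.Finite Rᵐᵒᵖ M] (f : N →ₗ[R] N')
    (g : N →ₗ[Q] N') (hfg : ∀ n, f n = g n) (hk : δ Q (LinearMap.ker g) ≤ e)
    (hc : δ Q (N' ⧸ LinearMap.range g) ≤ e) :
    δ Q (LinearMap.ker (lTensor (Q := Q) M f fun q n => by rw [hfg, hfg, map_smul])) ≤ e := by
  obtain ⟨n, π, hπ⟩ := Module.Finite.exists_fin' Rᵐᵒᵖ M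
  have hexact := LinearMap.exact_subtype_ker_map π
  have hg (q : Q) (n : N) : f (q • n) = q • f n := by rw [hfg, hfg, map_smul]
  exact h.ker_le_of_exact_rows (i := rTensor Q N (LinearMap.ker π).subtype)
    (p := rTensor Q N π) (i' := rTensor Q N' (LinearMap.ker π).subtype) (p' := rTensor Q N' π)
    (exact_map_left hexact hπ) (map_surjective hπ Function.surjective_id)
    (exact_map_left hexact hπ) (lTensor_rTensor _ f hg) (lTensor_rTensor _ f hg)
    (dim_coker_lTensor_le _ h f g hfg hc) (dim_ker_lTensor_pi_le h n f g hfg hk)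

end Dimension

section Assoc

variable {R S Q X N P : Type u} [Ring R] [Ring S] [Ring Q] [AddCommGroup X] [Module Rᵐᵒᵖ X]
  [AddCommGroup N] [Module R N] [Module Sᵐᵒᵖ N] [SMulCommClass R Sᵐᵒᵖ N] [SMulCommClass Sᵐᵒᵖ R N]
  [AddCommGroup P] [Module S P] [Module Q P] [SMulCommClass Q S P]

instance : SMulCommClass Q R (NCTensor S N P) where
  smul_comm q r x := by
    induction x using induction_on with
    | tmul n p => rfl
    | add x y hx hy => simp only [smul_add, hx, hy]

omit [SMulCommClass R Sᵐᵒᵖ N] in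
theorem induction_on_left {p : NCTensor S (NCTensor R X N) P → Prop}
    (t : NCTensor S (NCTensor R X N) P) (tmul : ∀ x n y, p (tmul S (tmul R x n) y))
    (add : ∀ t t', p t → p t' → p (t + t')) : p t := by
  induction t using induction_on with
  | tmul t y =>
    induction t using induction_on with
    | tmul x n => exact tmul x n y
    | add t t' ht ht' =>
      rw [add_tmul]
      exact add _ _ ht ht'
  | add t t' ht ht' => exact add t t' ht ht'

omit [SMulCommClass Sᵐᵒᵖ R N] in
theorem induction_on_right {p : NCTensor R X (NCTensor S N P) → Prop}
    (t : NCTensor R X (NCTensor S N P)) (tmul : ∀ x n y, p (tmul R x (tmul S n y)))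
    (add : ∀ t t', p t → p t' → p (t + t')) : p t := by
  induction t using induction_on with
  | tmul x t =>
    induction t using induction_on with
    | tmul n y => exact tmul x n y
    | add t t' ht ht' =>
      rw [tmul_add]
      exact add _ _ ht ht'
  | add t t' ht ht' => exact add t t' ht ht'

variable (R S X N P) in
/-- The map `x ⊗ n ↦ (p ↦ x ⊗ (n ⊗ p))`. -/
noncomputable def assocCurried : NCTensor R X N →+ P →+ NCTensor R X (NCTensor S N P) :=
  lift (AddMonoidHom.mk'
      (fun x => (AddMonoidHom.compHom (tmulHom R X (NCTensor S N P) x)).comp (tmulHom S N P))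
      fun x x' => AddMonoidHom.ext fun n => AddMonoidHom.ext fun p => add_tmul x x' (tmul S n p))
    fun x r n => AddMonoidHom.ext fun p => smul_tmul r x (tmul S n p)

variable (R S X N P) in
/-- The associativity map `(x ⊗ n) ⊗ p ↦ x ⊗ (n ⊗ p)`. -/
noncomputable def assocHom :
    NCTensor S (NCTensor R X N) P →+ NCTensor R X (NCTensor S N P) :=
  lift (assocCurried R S X N P) fun t s p => by
    induction t using induction_on with
    | tmul x n => exact congrArg (tmul R x) (smul_tmul s n p)
    | add t t' ht ht' =>
      rw [smul_add, map_add, map_add, AddMonoidHom.add_apply, AddMonoidHom.add_apply, ht, ht']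

variable (R S X N P) in
/-- The map `x ↦ (n ⊗ p ↦ (x ⊗ n) ⊗ p)`. -/
noncomputable def assocSymmCurried : X →+ NCTensor S N P →+ NCTensor S (NCTensor R X N) P :=
  AddMonoidHom.mk' (fun x => lift ((tmulHom S (NCTensor R X N) P).comp (tmulHom R X N x))
      fun n s p => smul_tmul s (tmul R x n) p)
    fun x x' => addHom_ext fun n p =>
      (congrArg (fun t => tmul S t p) (add_tmul x x' n)).trans (add_tmul _ _ p)

variable (R S X N P) in
/-- The map `x ⊗ (n ⊗ p) ↦ (x ⊗ n) ⊗ p`. -/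
noncomputable def assocSymmHom :
    NCTensor R X (NCTensor S N P) →+ NCTensor S (NCTensor R X N) P :=
  lift (assocSymmCurried R S X N P) fun x r t => by
    induction t using induction_on with
    | tmul n p => exact congrArg (fun y => tmul S y p) (smul_tmul r x n)
    | add t t' ht ht' => rw [smul_add, map_add, map_add, ht, ht']

variable (R S Q X N P) in
/-- The associativity of the tensor product. -/
noncomputable def assoc :
    NCTensor S (NCTensor R X N) P ≃ₗ[Q] NCTensor R X (NCTensor S N P) where
  toFun := assocHom R S X N P
  invFun := assocSymmHom R S X N P
  map_add' := map_add _
  map_smul' q t := by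
    induction t using induction_on_left with
    | tmul x n p => rfl
    | add t t' ht ht' => rw [smul_add, map_add, ht, ht', map_add, smul_add]
  left_inv t := by
    induction t using induction_on_left with
    | tmul x n p => rfl
    | add t t' ht ht' => rw [map_add, map_add, ht, ht']
  right_inv t := by
    induction t using induction_on_right with
    | tmul x n p => rfl
    | add t t' ht ht' => rw [map_add, map_add, ht, ht']

theorem assoc_rTensor_rTensor {X' : Type u} [AddCommGroup X'] [Module Rᵐᵒᵖ X']
    (f : X →ₗ[Rᵐᵒᵖ] X') (t : NCTensor S (NCTensor R X N) P) :
    assoc R S Q X' N P (rTensor Q P (rTensor Sᵐᵒᵖ N f) t) =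
      rTensor Q (NCTensor S N P) f (assoc R S Q X N P t) := by
  induction t using induction_on_left with
  | tmul x n p => rfl
  | add t t' ht ht' => rw [map_add, map_add, ht, ht', map_add, map_add]

end Assoc

/-- The isomorphism `x ↦ x ⊗ 1`. -/
noncomputable def unit (R X : Type u) [Ring R] [AddCommGroup X] [Module Rᵐᵒᵖ X] :
    X ≃ₗ[Rᵐᵒᵖ] NCTensor R X R where
  toFun x := tmul R x 1
  invFun := lift
    (AddMonoidHom.mk' (fun x => AddMonoidHom.mk' (fun r => MulOpposite.op r • x)
      fun r s => by rw [MulOpposite.op_add, add_smul])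
      fun x y => AddMonoidHom.ext fun r => smul_add (MulOpposite.op r) x y)
    fun x r s => smul_smul (MulOpposite.op s) (MulOpposite.op r) x
  map_add' x y := add_tmul x y 1
  map_smul' r x := (smul_tmul r.unop x 1).trans
    (congrArg (tmul R x) ((mul_one r.unop).trans (one_mul r.unop).symm))
  left_inv x := one_smul Rᵐᵒᵖ x
  right_inv t := by
    induction t using induction_on with
    | tmul x r => exact (smul_tmul r x 1).trans (congrArg (tmul R x) (mul_one r))
    | add t t' ht ht' =>
      rw [map_add]
      exact (add_tmul _ _ _).trans (congrArg₂ (· + ·) ht ht')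

end NCTensor

/-! ### The first left derived functor and kernels -/

section LeftDerived

variable {A B : Type u} [Ring A] [Ring B]

section Lift

variable {X₁ X₂ X₃ P₀ P₁ : Type*} [AddCommGroup X₁] [Module A X₁] [AddCommGroup X₂] [Module A X₂]
  [AddCommGroup X₃] [Module A X₃] [AddCommGroup P₀] [Module A P₀] [AddCommGroup P₁] [Module A P₁]
  {f : X₁ →ₗ[A] X₂} {g : X₂ →ₗ[A] X₃} {d : P₁ →ₗ[A] P₀} {p : P₀ →ₗ[A] X₃} {a₀ : P₀ →ₗ[A] X₂}
  {a₁ : P₁ →ₗ[A] X₁}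

theorem exact_prod_coprod_of_lift (hf : Function.Injective f) (hfg : Function.Exact f g)
    (hdp : Function.Exact d p) (ha₀ : ∀ x, g (a₀ x) = p x) (ha₁ : ∀ y, f (a₁ y) = a₀ (d y)) :
    Function.Exact (a₁.prod d) (f.coprod (-a₀)) := by
  rintro ⟨x, y⟩
  rw [LinearMap.coprod_apply, LinearMap.neg_apply, ← sub_eq_add_neg, sub_eq_zero]
  constructor
  · intro hxy
    obtain ⟨z, rfl⟩ := (hdp y).1 (by rw [← ha₀, ← hxy, hfg.apply_apply_eq_zero])
    exact ⟨z, Prod.ext (hf ((ha₁ z).trans hxy.symm)) rfl⟩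
  · rintro ⟨z, hz⟩
    obtain ⟨rfl, rfl⟩ := Prod.ext_iff.1 hz
    exact ha₁ z

theorem coprod_surjective_of_lift (hfg : Function.Exact f g) (hp : Function.Surjective p)
    (ha₀ : ∀ x, g (a₀ x) = p x) : Function.Surjective (f.coprod (-a₀)) := by
  intro y
  obtain ⟨z, hz⟩ := hp (g y)
  obtain ⟨x, hx⟩ := (hfg (y - a₀ z)).1 (by rw [map_sub, ha₀, hz, sub_self])
  exact ⟨(x, -z), by rw [LinearMap.coprod_apply, hx, LinearMap.neg_apply, map_neg, neg_neg,
    sub_add_cancel]⟩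

end Lift

theorem exists_map_eq_of_prod_coprod_exact (F : ModuleCat.{u} A ⥤ ModuleCat.{u} B) [F.Additive]
    [Limits.PreservesFiniteColimits F] {X₁ X₂ P₀ P₁ : ModuleCat.{u} A} {f : X₁ ⟶ X₂}
    {d : P₁ ⟶ P₀} {a₀ : P₀ ⟶ X₂} {a₁ : P₁ ⟶ X₁}
    (hex : Function.Exact (a₁.hom.prod d.hom) (f.hom.coprod (-a₀.hom)))
    (hsurj : Function.Surjective (f.hom.coprod (-a₀.hom))) {t : F.obj X₁}
    (ht : (F.map f).hom t = 0) : ∃ z, (F.map d).hom z = 0 ∧ (F.map a₁).hom z = t := by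
  let E := ModuleCat.of A (X₁ × P₀)
  let φ : P₁ ⟶ E := ModuleCat.ofHom (a₁.hom.prod d.hom)
  let χ : E ⟶ X₂ := ModuleCat.ofHom (f.hom.coprod (-a₀.hom))
  have hφχ : φ ≫ χ = 0 := ModuleCat.hom_ext hex.linearMap_comp_eq_zero
  have hFex := ((F.preservesFiniteColimits_tfae.out 3 1 :).1 inferInstance (.mk φ χ hφχ)
    ⟨(ShortComplex.ShortExact.moduleCat_exact_iff_function_exact _).2 hex,
      (ModuleCat.epi_iff_surjective χ).2 hsurj⟩).1
  let ι : X₁ ⟶ E := ModuleCat.ofHom (LinearMap.inl A _ _)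
  let pr₁ : E ⟶ X₁ := ModuleCat.ofHom (LinearMap.fst A _ _)
  let pr₂ : E ⟶ P₀ := ModuleCat.ofHom (LinearMap.snd A _ _)
  have hιχ : ι ≫ χ = f := ModuleCat.hom_ext (LinearMap.coprod_inl _ _)
  obtain ⟨z, hz : (F.map φ).hom z = (F.map ι).hom t⟩ :=
    (ShortComplex.moduleCat_exact_iff _).1 hFex ((F.map ι).hom t) (by
      change (F.map ι ≫ F.map χ).hom t = 0
      rwa [← F.map_comp, hιχ])
  refine ⟨z, ?_, ?_⟩
  · have hz₂ : (F.map φ ≫ F.map pr₂).hom z = (F.map ι ≫ F.map pr₂).hom t :=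
      congrArg (F.map pr₂).hom hz
    rwa [← F.map_comp, ← F.map_comp, show φ ≫ pr₂ = d from rfl, show ι ≫ pr₂ = 0 from rfl,
      F.map_zero] at hz₂
  · have hz₁ : (F.map φ ≫ F.map pr₁).hom z = (F.map ι ≫ F.map pr₁).hom t :=
      congrArg (F.map pr₁).hom hz
    rwa [← F.map_comp, ← F.map_comp, show φ ≫ pr₁ = a₁ from rfl, show ι ≫ pr₁ = 𝟙 _ from rfl,
      F.map_id] at hz₁

theorem exists_homology_hom (K : ChainComplex (ModuleCat.{u} B) ℕ) {n : ℕ} {Y : ModuleCat.{u} B}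
    (b : K.X (n + 1) ⟶ Y) (hb : K.d (n + 2) (n + 1) ≫ b = 0) :
    ∃ τ : K.homology (n + 1) ⟶ Y,
      ∀ z, (K.d (n + 1) n).hom z = 0 → b.hom z ∈ LinearMap.range τ.hom := by
  let τ : K.opcycles (n + 1) ⟶ Y := K.descOpcycles b (n + 2) (by simp) hb
  refine ⟨K.homologyι (n + 1) ≫ τ, fun z hz => ?_⟩
  let ζ : ModuleCat.of B B ⟶ K.X (n + 1) := ModuleCat.ofHom (LinearMap.toSpanSingleton B _ z)
  have hζ : ζ ≫ K.d (n + 1) n = 0 := by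
    ext
    change (K.d (n + 1) n).hom ((1 : B) • z) = 0
    rw [one_smul, hz]
  let c : ModuleCat.of B B ⟶ K.cycles (n + 1) := K.liftCycles ζ n (by simp) hζ
  have hc : (c ≫ K.homologyπ (n + 1)) ≫ K.homologyι (n + 1) ≫ τ = ζ ≫ b := by
    rw [Category.assoc, K.homology_π_ι_assoc, K.liftCycles_i_assoc, K.p_descOpcycles]
  refine ⟨(c ≫ K.homologyπ (n + 1)).hom (1 : B), ?_⟩
  exact (congrArg (fun f => f.hom (1 : B)) hc).trans (congrArg b.hom (one_smul B z))

/-- The part of the long exact sequence of left derived functors that computes the kernel of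
`F X₁ ⟶ F X₂`. -/
theorem exists_leftDerived_one_ker_le_range (F : ModuleCat.{u} A ⥤ ModuleCat.{u} B) [F.Additive]
    [Limits.PreservesFiniteColimits F] {S : ShortComplex (ModuleCat.{u} A)} (hS : S.ShortExact) :
    ∃ τ : (F.leftDerived 1).obj S.X₃ ⟶ F.obj S.X₁,
      LinearMap.ker (F.map S.f).hom ≤ LinearMap.range τ.hom := by
  let P := projectiveResolution S.X₃
  have := hS.mono_f
  have := hS.epi_g
  let p : P.complex.X 0 ⟶ S.X₃ := P.π.f 0
  let d : P.complex.X 1 ⟶ P.complex.X 0 := P.complex.d 1 0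
  let a₀ : P.complex.X 0 ⟶ S.X₂ := Projective.factorThru p S.g
  have ha₀ : a₀ ≫ S.g = p := Projective.factorThru_comp _ _
  let a₁ : P.complex.X 1 ⟶ S.X₁ := hS.exact.lift (d ≫ a₀) (by
    rw [Category.assoc, ha₀]
    exact P.complex_d_comp_π_f_zero)
  have ha₁ : a₁ ≫ S.f = d ≫ a₀ := hS.exact.lift_f _ _
  have ha₁' : P.complex.d 2 1 ≫ a₁ = 0 := by
    rw [← cancel_mono S.f, Category.assoc, ha₁, ← Category.assoc, P.complex.d_comp_d,
      Limits.zero_comp, Limits.zero_comp]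
  let K := (F.mapHomologicalComplex (ComplexShape.down ℕ)).obj P.complex
  obtain ⟨τ, hτ⟩ := exists_homology_hom K (n := 0) (F.map a₁) (by
    change F.map (P.complex.d 2 1) ≫ F.map a₁ = 0
    rw [← F.map_comp, ha₁', F.map_zero])
  have hfg := (ShortComplex.ShortExact.moduleCat_exact_iff_function_exact S).1 hS.exact
  have hdp := (ShortComplex.ShortExact.moduleCat_exact_iff_function_exact _).1 P.exact₀
  have hp : Function.Surjective p :=
    (ModuleCat.epi_iff_surjective p).1 (inferInstanceAs (Epi (P.π.f 0)))
  have ha₀' (x) : S.g.hom (a₀.hom x) = p.hom x := congrArg (fun f => f.hom x) ha₀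
  let e : (F.leftDerived 1).obj S.X₃ ≅ K.homology 1 := P.isoLeftDerivedObj F 1
  refine ⟨e.hom ≫ τ, fun t ht => ?_⟩
  obtain ⟨z, hdz, rfl⟩ := exists_map_eq_of_prod_coprod_exact F
    (exact_prod_coprod_of_lift ((ModuleCat.mono_iff_injective S.f).1 hS.mono_f) hfg hdp ha₀'
      fun y => congrArg (fun f => f.hom y) ha₁)
    (coprod_surjective_of_lift hfg hp ha₀') ht
  obtain ⟨w, hw⟩ := hτ z hdz
  exact ⟨e.inv.hom w, (congrArg (fun f => τ.hom (f.hom w)) e.inv_hom_id).trans hw⟩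

end LeftDerived

namespace AlgBimodule

attribute [local instance] NCTensor.leftAction NCTensor.rightAction

variable {k : Type v} [CommRing k] {A B : Type u} [Ring A] [Algebra k A] [Ring B] [Algebra k B]

instance (M : AlgBimodule k A B) : Limits.PreservesFiniteColimits M.tensorRightFunctor := by
  refine (M.tensorRightFunctor.preservesFiniteColimits_tfae.out 0 3).1 fun S hS => ?_
  have hg : Function.Surjective S.g := (ModuleCat.epi_iff_surjective _).1 hS.epi_g
  have hfg := (ShortComplex.ShortExact.moduleCat_exact_iff_function_exact S).1 hS.exact
  constructor
  · rw [ShortComplex.ShortExact.moduleCat_exact_iff_function_exact]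
    exact NCTensor.exact_map_left hfg hg
  · rw [ModuleCat.epi_iff_surjective]
    exact NCTensor.map_surjective hg Function.surjective_id

end AlgBimodule

namespace DimFunction

attribute [local instance] NCTensor.leftAction NCTensor.rightAction

variable {δ : DimFunction.{u}} {n : ℤ} {k : Type v} [CommRing k] {A B : Type u} [Ring A]
  [Algebra k A] [Ring B] [Algebra k B]

/-- The half of the condition `γ_{n,1}` that concerns tensoring right modules with `M`. -/
def RightGamma (δ : DimFunction.{u}) (n : ℤ) (M : AlgBimodule k A B) : Prop :=
  ∀ N : ModuleCat.{u} Aᵐᵒᵖ, δ.IsSmall n Aᵐᵒᵖ N → ∀ j ≤ 1, δ.IsSmall n Bᵐᵒᵖ (M.torRight j N)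

namespace RightGamma

variable {M : AlgBimodule k A B} (hM : δ.RightGamma n M) (hB : δ.IsExact Bᵐᵒᵖ)
variable {X Y : Type u} [AddCommGroup X] [Module Aᵐᵒᵖ X] [AddCommGroup Y] [Module Aᵐᵒᵖ Y]

include hM hB

theorem dim_tensor_le [Module.Finite Aᵐᵒᵖ X]
    (hX : δ Aᵐᵒᵖ X ≤ ((n : ℝ) : EReal)) : δ Bᵐᵒᵖ (NCTensor A X M) ≤ ((n : ℝ) : EReal) := by
  have h := (hM (ModuleCat.of Aᵐᵒᵖ X) ⟨inferInstance, hX⟩ 0 zero_le_one).2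
  let e := (M.tensorRightFunctor.leftDerivedZeroIsoSelf.app (ModuleCat.of Aᵐᵒᵖ X)).toLinearEquiv
  exact (hB.le_of_surjective e.toLinearMap e.surjective).trans h

theorem dim_ker_le_of_surjective [IsNoetherianRing Aᵐᵒᵖ] [Module.Finite Aᵐᵒᵖ X]
    (f : X →ₗ[Aᵐᵒᵖ] Y) (hf : Function.Surjective f)
    (hk : δ Aᵐᵒᵖ (LinearMap.ker f) ≤ ((n : ℝ) : EReal)) :
    δ Bᵐᵒᵖ (LinearMap.ker (NCTensor.rTensor (R := A) Bᵐᵒᵖ M f)) ≤ ((n : ℝ) : EReal) := by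
  refine (hB.submodule_mono fun t ht => ?_).trans ((hB.range_le
    (NCTensor.rTensor (R := A) Bᵐᵒᵖ M (LinearMap.ker f).subtype)).trans (hM.dim_tensor_le hB hk))
  exact (NCTensor.exact_map_left (N := M) (LinearMap.exact_subtype_ker_map f) hf t).1 ht

theorem dim_ker_le_of_injective [Module.Finite Aᵐᵒᵖ Y]
    (f : X →ₗ[Aᵐᵒᵖ] Y) (hf : Function.Injective f)
    (hc : δ Aᵐᵒᵖ (Y ⧸ LinearMap.range f) ≤ ((n : ℝ) : EReal)) :
    δ Bᵐᵒᵖ (LinearMap.ker (NCTensor.rTensor (R := A) Bᵐᵒᵖ M f)) ≤ ((n : ℝ) : EReal) := by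
  have hS := shortExact_moduleCat hf (LinearMap.exact_map_mkQ_range f) (Submodule.mkQ_surjective _)
  obtain ⟨τ, hτ⟩ := exists_leftDerived_one_ker_le_range M.tensorRightFunctor hS
  exact (hB.submodule_mono hτ).trans ((hB.range_le τ.hom).trans
    (hM (ModuleCat.of Aᵐᵒᵖ (Y ⧸ LinearMap.range f)) ⟨inferInstance, hc⟩ 1 le_rfl).2)

theorem dim_ker_le [IsNoetherianRing Aᵐᵒᵖ] [Module.Finite Aᵐᵒᵖ X]
    [Module.Finite Aᵐᵒᵖ Y] (f : X →ₗ[Aᵐᵒᵖ] Y)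
    (hk : δ Aᵐᵒᵖ (LinearMap.ker f) ≤ ((n : ℝ) : EReal))
    (hc : δ Aᵐᵒᵖ (Y ⧸ LinearMap.range f) ≤ ((n : ℝ) : EReal)) :
    δ Bᵐᵒᵖ (LinearMap.ker (NCTensor.rTensor (R := A) Bᵐᵒᵖ M f)) ≤ ((n : ℝ) : EReal) := by
  have hf : NCTensor.rTensor (R := A) Bᵐᵒᵖ M f =
      NCTensor.rTensor (R := A) Bᵐᵒᵖ M (LinearMap.range f).subtype ∘ₗ
        NCTensor.rTensor (R := A) Bᵐᵒᵖ M f.rangeRestrict :=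
    NCTensor.linearMap_ext fun _ _ => rfl
  rw [hf]
  refine hB.ker_comp_le _ _ ?_ ?_
  · exact hM.dim_ker_le_of_surjective hB f.rangeRestrict f.surjective_rangeRestrict
      (by rwa [LinearMap.ker_rangeRestrict])
  · exact hM.dim_ker_le_of_injective hB (LinearMap.range f).subtype
      (LinearMap.range f).injective_subtype (by rwa [Submodule.range_subtype])

theorem dim_coker_le [Module.Finite Aᵐᵒᵖ Y] (f : X →ₗ[Aᵐᵒᵖ] Y)
    (hc : δ Aᵐᵒᵖ (Y ⧸ LinearMap.range f) ≤ ((n : ℝ) : EReal)) :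
    δ Bᵐᵒᵖ (NCTensor A Y M ⧸ LinearMap.range (NCTensor.rTensor (R := A) Bᵐᵒᵖ M f)) ≤
      ((n : ℝ) : EReal) :=
  (hB.coker_le_of_exact (p := NCTensor.rTensor (R := A) Bᵐᵒᵖ M (LinearMap.range f).mkQ)
    (NCTensor.exact_map_left (LinearMap.exact_map_mkQ_range f)
      (Submodule.mkQ_surjective _))).trans (hM.dim_tensor_le hB hc)

end RightGamma

end DimFunction

/-! ### Isomorphisms of bimodules up to small modules -/

namespace DimFunction.IsExact

variable {δ : DimFunction.{u}} {R : Type u} [Ring R] (h : δ.IsExact R) {e : EReal}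
variable {X Y P Q : Type u} [AddCommGroup X] [Module R X] [AddCommGroup Y] [Module R Y]
  [AddCommGroup P] [Module R P] [AddCommGroup Q] [Module R Q]
  {f : X →ₗ[R] Y} {g : X →ₗ[R] P} {i : Y →ₗ[R] Q} {j : P →ₗ[R] Q}

include h

theorem ker_le_of_pushout (hex : ∀ y p, i y = j p → ∃ x, f x = y ∧ g x = p)
    (hf : δ R (LinearMap.ker f) ≤ e) : δ R (LinearMap.ker j) ≤ e := by
  refine (h.submodule_mono fun p hp => ?_).trans
    ((h.range_le (g ∘ₗ (LinearMap.ker f).subtype)).trans hf)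
  obtain ⟨x, hx, rfl⟩ := hex 0 p (by rw [map_zero, LinearMap.mem_ker.1 hp])
  exact ⟨⟨x, hx⟩, rfl⟩

theorem coker_le_of_pushout (hcomm : ∀ x, i (f x) = j (g x))
    (hsurj : ∀ q, ∃ y p, q = i y + j p) (hf : δ R (Y ⧸ LinearMap.range f) ≤ e) :
    δ R (Q ⧸ LinearMap.range j) ≤ e := by
  have hi : LinearMap.range f ≤ (LinearMap.range j).comap i := by
    rintro _ ⟨x, rfl⟩
    exact ⟨g x, (hcomm x).symm⟩
  refine (h.le_of_surjective (Submodule.mapQ _ _ i hi) fun q => ?_).trans hf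
  obtain ⟨q, rfl⟩ := Submodule.Quotient.mk_surjective _ q
  obtain ⟨y, p, rfl⟩ := hsurj q
  refine ⟨Submodule.Quotient.mk y, ((Submodule.Quotient.eq _).2 ?_).symm⟩
  exact ⟨p, (add_sub_cancel_left _ _).symm⟩

end DimFunction.IsExact

namespace AlgBimodule

variable {δ : DimFunction.{u}} {n : ℤ} {k : Type v} [CommRing k] {A B : Type u} [Ring A]
  [Algebra k A] [Ring B] [Algebra k B]

section Constructions

variable (T : AlgBimodule k A B) (W : Submodule Bᵐᵒᵖ T) (hW : ∀ (a : A), ∀ m ∈ W, a • m ∈ W)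

/-- The subbimodule given by a right submodule that is stable on the left. -/
def ofStable : AlgBimodule k A B :=
  let := moduleOfStable W hW
  { carrier := W
    smulCommClass := ⟨fun a b x => Subtype.ext (smul_comm a b x.1)⟩
    central := fun c x => Subtype.ext (T.central c x.1) }

/-- The inclusion of a subbimodule. -/
def ofStableHom : Hom (T.ofStable W hW) T where
  toLinearMap := W.subtype
  map_left_smul _ _ := rfl

/-- The quotient bimodule by a right submodule that is stable on the left. -/
def quotient : AlgBimodule k A B :=
  let := quotientModuleOfStable W hW
  { carrier := T ⧸ W
    smulCommClass := ⟨fun a b x => by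
      obtain ⟨x, rfl⟩ := Submodule.Quotient.mk_surjective _ x
      exact congrArg Submodule.Quotient.mk (smul_comm a b x)⟩
    central := fun c x => by
      obtain ⟨x, rfl⟩ := Submodule.Quotient.mk_surjective _ x
      exact congrArg Submodule.Quotient.mk (T.central c x) }

/-- The projection to a quotient bimodule. -/
def quotientHom : Hom T (T.quotient W hW) where
  toLinearMap := W.mkQ
  map_left_smul _ _ := rfl

/-- The direct sum of two bimodules. -/
def prod (X Y : AlgBimodule k A B) : AlgBimodule k A B where
  carrier := X × Y
  central c x := Prod.ext (X.central c x.1) (Y.central c x.2)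

end Constructions

namespace Hom

variable {X Y Z P : AlgBimodule k A B}

/-- A bimodule morphism as a map of left modules. -/
def toLeftLinearMap (f : Hom X Y) : X →ₗ[A] Y :=
  { f.toLinearMap with map_smul' := f.map_left_smul }

/-- The composition of bimodule morphisms. -/
def comp (g : Hom Y Z) (f : Hom X Y) : Hom X Z where
  toLinearMap := g.toLinearMap ∘ₗ f.toLinearMap
  map_left_smul := (g.toLeftLinearMap ∘ₗ f.toLeftLinearMap).map_smul

theorem IsNIso.comp (hB : δ.IsExact Bᵐᵒᵖ) {g : Hom Y Z} {f : Hom X Y} (hg : g.IsNIso δ n)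
    (hf : f.IsNIso δ n) : (g.comp f).IsNIso δ n :=
  ⟨hB.ker_comp_le f.toLinearMap g.toLinearMap hf.1 hg.1,
    hB.coker_comp_le f.toLinearMap g.toLinearMap hf.2 hg.2⟩

variable (f : Hom X Y) (g : Hom X P)

theorem smul_mem_range_prod_neg (a : A) :
    ∀ m ∈ LinearMap.range (f.toLinearMap.prod (-g.toLinearMap)),
      a • m ∈ LinearMap.range (f.toLinearMap.prod (-g.toLinearMap)) := by
  rintro _ ⟨x, rfl⟩
  exact ⟨a • x, Prod.ext (f.map_left_smul a x)
    ((congrArg Neg.neg (g.map_left_smul a x)).trans (smul_neg a _).symm)⟩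

/-- The pushout of two bimodule morphisms with the same source. -/
def pushout : AlgBimodule k A B :=
  (Y.prod P).quotient (LinearMap.range (f.toLinearMap.prod (-g.toLinearMap)))
    (smul_mem_range_prod_neg f g)

/-- The first map into the pushout. -/
def pushoutInl : Hom Y (pushout f g) :=
  ((Y.prod P).quotientHom _ _).comp
    { toLinearMap := LinearMap.inl Bᵐᵒᵖ Y P
      map_left_smul := (LinearMap.inl A Y P).map_smul }

/-- The second map into the pushout. -/
def pushoutInr : Hom P (pushout f g) :=
  ((Y.prod P).quotientHom _ _).comp
    { toLinearMap := LinearMap.inr Bᵐᵒᵖ Y P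
      map_left_smul := (LinearMap.inr A Y P).map_smul }

theorem pushoutInl_eq_pushoutInr (x : X) :
    (pushoutInl f g).toLinearMap (f.toLinearMap x) =
      (pushoutInr f g).toLinearMap (g.toLinearMap x) :=
  (Submodule.Quotient.eq _).2 ⟨x, Prod.ext (sub_zero _).symm (zero_sub _).symm⟩

variable {f g}

theorem exists_of_pushoutInl_eq_pushoutInr {y : Y} {p : P}
    (hyp : (pushoutInl f g).toLinearMap y = (pushoutInr f g).toLinearMap p) :
    ∃ x, f.toLinearMap x = y ∧ g.toLinearMap x = p := by
  obtain ⟨x, hx⟩ := (Submodule.Quotient.eq _).1 hyp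
  exact ⟨x, (congrArg Prod.fst hx).trans (sub_zero y),
    neg_injective ((congrArg Prod.snd hx).trans (zero_sub p))⟩

theorem exists_eq_pushoutInl_add_pushoutInr (q : pushout f g) :
    ∃ y p, q = (pushoutInl f g).toLinearMap y + (pushoutInr f g).toLinearMap p := by
  obtain ⟨⟨y, p⟩, rfl⟩ := Submodule.Quotient.mk_surjective _ q
  exact ⟨y, p, congrArg Submodule.Quotient.mk (Prod.ext (add_zero y).symm (zero_add p).symm)⟩

theorem IsNIso.pushoutInr (hB : δ.IsExact Bᵐᵒᵖ) (hf : f.IsNIso δ n) :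
    (pushoutInr f g).IsNIso δ n :=
  ⟨hB.ker_le_of_pushout (fun _ _ => exists_of_pushoutInl_eq_pushoutInr) hf.1,
    hB.coker_le_of_pushout (pushoutInl_eq_pushoutInr f g) exists_eq_pushoutInl_add_pushoutInr hf.2⟩

theorem IsNIso.pushoutInl (hB : δ.IsExact Bᵐᵒᵖ) (hg : g.IsNIso δ n) :
    (pushoutInl f g).IsNIso δ n := by
  refine ⟨hB.ker_le_of_pushout (g := f.toLinearMap) (i := (f.pushoutInr g).toLinearMap)
      (fun p y hpy => ?_) hg.1,
    hB.coker_le_of_pushout (fun x => (pushoutInl_eq_pushoutInr f g x).symm) (fun q => ?_) hg.2⟩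
  · obtain ⟨x, hy, hp⟩ := exists_of_pushoutInl_eq_pushoutInr hpy.symm
    exact ⟨x, hp, hy⟩
  · obtain ⟨y, p, hq⟩ := exists_eq_pushoutInl_add_pushoutInr q
    exact ⟨p, y, hq.trans (add_comm _ _)⟩

end Hom

theorem NIsomorphic.of_isNIso (hB : δ.IsExact Bᵐᵒᵖ) {X Y Z : AlgBimodule k A B} {f : Hom X Y}
    (hf : f.IsNIso δ n) (hXZ : X.NIsomorphic δ n Z) : Y.NIsomorphic δ n Z := by
  obtain ⟨P, g, h, hg, hh⟩ := hXZ
  exact ⟨f.pushout g, f.pushoutInl g, (f.pushoutInr g).comp h, hg.pushoutInl hB,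
    (hf.pushoutInr hB).comp hB hh⟩

end AlgBimodule

section Tensor

attribute [local instance] NCTensor.leftAction NCTensor.rightAction

theorem NCTensor.map_smul_left {R S M M' N N' : Type u} [Ring R] [Ring S] [AddCommGroup M]
    [Module Rᵐᵒᵖ M] [Module S M] [SMulCommClass S Rᵐᵒᵖ M] [AddCommGroup M'] [Module Rᵐᵒᵖ M']
    [Module S M'] [SMulCommClass S Rᵐᵒᵖ M'] [AddCommGroup N] [Module R N] [AddCommGroup N']
    [Module R N'] {f : M →ₗ[Rᵐᵒᵖ] M'} (hf : ∀ (s : S) (m : M), f (s • m) = s • f m)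
    (g : N →ₗ[R] N') (s : S) (t : NCTensor R M N) : map f g (s • t) = s • map f g t := by
  induction t using induction_on with
  | tmul m n => exact congrArg (fun z => tmul R z (g n)) (hf s m)
  | add t t' ht ht' => rw [smul_add, map_add, ht, ht', map_add, smul_add]

namespace AlgBimodule.Hom

variable {δ : DimFunction.{u}} {n : ℤ} {k : Type v} [CommRing k] {A B C : Type u} [Ring A]
  [Algebra k A] [Ring B] [Algebra k B] [Ring C] [Algebra k C]
variable {X X' : AlgBimodule k A B} {Y Y' : AlgBimodule k B C}

/-- The functoriality of the tensor product of bimodules. -/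
def tensor (f : Hom X X') (g : Hom Y Y') : Hom (X.tensor Y) (X'.tensor Y') where
  toLinearMap :=
    NCTensor.mapLinear f.toLinearMap g.toLeftLinearMap fun c => g.toLinearMap.map_smul c
  map_left_smul := NCTensor.map_smul_left f.map_left_smul g.toLeftLinearMap

theorem IsNIso.tensor [IsNoetherianRing Bᵐᵒᵖ] (hC : δ.IsExact Cᵐᵒᵖ) {f : Hom X X'}
    {g : Hom Y Y'} (hf : f.IsNIso δ n) (hg : g.IsNIso δ n) (hY : δ.RightGamma n Y)
    [Module.Finite Bᵐᵒᵖ X] [Module.Finite Bᵐᵒᵖ X'] : (f.tensor g).IsNIso δ n := by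
  have hfg : (f.tensor g).toLinearMap = NCTensor.lTensor (R := B) (Q := Cᵐᵒᵖ) X' g.toLeftLinearMap
      (fun c y => g.toLinearMap.map_smul c y) ∘ₗ NCTensor.rTensor (R := B) Cᵐᵒᵖ Y f.toLinearMap :=
    NCTensor.linearMap_ext fun _ _ => rfl
  rw [IsNIso, hfg]
  exact ⟨hC.ker_comp_le _ _ (hY.dim_ker_le hC f.toLinearMap hf.1 hf.2)
      (NCTensor.dim_ker_lTensor_le hC g.toLeftLinearMap g.toLinearMap (fun _ => rfl) hg.1 hg.2),
    hC.coker_comp_le _ _ (hY.dim_coker_le hC f.toLinearMap hf.2)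
      (NCTensor.dim_coker_lTensor_le X' hC g.toLeftLinearMap g.toLinearMap (fun _ => rfl) hg.2)⟩

end AlgBimodule.Hom

end Tensor

/-! ### The torsion of an invertible bimodule -/

namespace DimFunction

variable {δ : DimFunction.{u}} {R : Type u} [Ring R] (h : δ.IsExact R) {e : EReal}
variable {X Y P : Type u} [AddCommGroup X] [Module R X] [AddCommGroup Y] [Module R Y]
  [AddCommGroup P] [Module R P]

include h

theorem IsExact.le_of_disjoint_range {K : Submodule R X} (f : X →ₗ[R] P) (g : Y →ₗ[R] P)
    (hf : δ R (LinearMap.ker f) ≤ e) (hg : δ R (P ⧸ LinearMap.range g) ≤ e)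
    (hK : Disjoint (K.map f) (LinearMap.range g)) : δ R K ≤ e := by
  have hinj : Function.Injective ((LinearMap.range g).mkQ ∘ₗ (K.map f).subtype) := by
    rw [← LinearMap.ker_eq_bot, LinearMap.ker_comp, Submodule.ker_mkQ]
    exact Submodule.disjoint_iff_comap_eq_bot.1 hK
  have hker : δ R (LinearMap.ker (f ∘ₗ K.subtype)) ≤ e :=
    h.ker_comp_le K.subtype f (h.ker_le_of_injective _ K.subtype_injective) hf
  exact h.le_of_dim_ker_le (f.submoduleMap K)
    ((h.submodule_mono fun _ hx => congrArg Subtype.val hx).trans hker)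
    ((h.le_of_injective _ hinj).trans hg)

theorem IsTorsionFree.disjoint_range (htf : IsTorsionFree δ e R X) {f : X →ₗ[R] P}
    (hf : Function.Injective f) {W : Submodule R P} (hW : δ R W ≤ e) :
    Disjoint W (LinearMap.range f) := by
  have hcomap : W.comap f = ⊥ := htf _ <|
    calc δ R (W.comap f) ≤ δ R ((W.comap f).map f) :=
          h.le_of_injective (f.submoduleMap _) (LinearMap.submoduleMap_injective hf _)
      _ ≤ e := (h.submodule_mono (Submodule.map_comap_le f W)).trans hW
  rw [disjoint_comm, disjoint_iff, ← Submodule.map_comap_eq, hcomap, Submodule.map_bot]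

end DimFunction

namespace AlgBimodule

open DimFunction

attribute [local instance] NCTensor.leftAction NCTensor.rightAction

variable {δ : DimFunction.{u}} {n : ℤ} {k : Type v} [CommRing k] {A B : Type u} [Ring A]
  [Algebra k A] [Ring B] [Algebra k B]

theorem NIsomorphic.dim_ker_rTensor_mkQ_torsion_le {e : EReal} (he : ((n : ℝ) : EReal) ≤ e)
    (hA : δ.IsExact A) (hA' : δ.IsExact Aᵐᵒᵖ) (hB' : δ.IsExact Bᵐᵒᵖ) [IsNoetherianRing Bᵐᵒᵖ]
    (hs : δ.IsSymmetric k A B) (hAl : IsTorsionFree δ e A A) (hAr : IsTorsionFree δ e Aᵐᵒᵖ A)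
    {T : AlgBimodule k A B} {T' : AlgBimodule k B A} [Module.Finite Bᵐᵒᵖ T] [Module.Finite B T']
    (hTT' : (T.tensor T').NIsomorphic δ n (AlgBimodule.regular k A)) :
    δ Aᵐᵒᵖ (LinearMap.ker (NCTensor.rTensor (R := B) Aᵐᵒᵖ T' (torsion δ e Bᵐᵒᵖ T).mkQ)) ≤
      ((n : ℝ) : EReal) := by
  obtain ⟨P, f, g, hf, hg⟩ := hTT'
  let N := T.ofStable (torsion δ e Bᵐᵒᵖ T) (smul_mem_torsion hB')
  have hN : δ A N ≤ e := (hs N).1 (inferInstanceAs (Module.Finite Bᵐᵒᵖ (torsion δ e Bᵐᵒᵖ T)))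
    |>.trans hB'.torsion_le
  let φ : Hom (N.tensor T') P := f.comp ((T.ofStableHom _ _).tensor ⟨LinearMap.id, fun _ _ => rfl⟩)
  have hφ : δ A (LinearMap.range φ.toLeftLinearMap) ≤ e :=
    (hA.range_le _).trans (NCTensor.dim_le_left hA hN)
  have hginj : Function.Injective g.toLinearMap := LinearMap.ker_eq_bot.1 (hAr _ (hg.1.trans he))
  have hdisj := hAl.disjoint_range hA (f := g.toLeftLinearMap) hginj hφ
  refine hA'.le_of_disjoint_range f.toLinearMap g.toLinearMap hf.1 hg.2 ?_
  rw [Submodule.disjoint_def] at hdisj ⊢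
  rintro _ ⟨t, ht, rfl⟩ hgt
  obtain ⟨s, rfl⟩ := (NCTensor.exact_map_left (N := T')
    (LinearMap.exact_subtype_mkQ (torsion δ e Bᵐᵒᵖ T)) (Submodule.mkQ_surjective _) t).1 ht
  exact hdisj _ ⟨s, rfl⟩ hgt

theorem NIsomorphic.dim_ker_rTensor_le (hB : δ.IsExact Bᵐᵒᵖ) [IsNoetherianRing Aᵐᵒᵖ]
    {X X' : Type u} [AddCommGroup X] [Module Aᵐᵒᵖ X] [AddCommGroup X'] [Module Aᵐᵒᵖ X']
    [Module.Finite Aᵐᵒᵖ X] [Module.Finite Aᵐᵒᵖ X'] (π : X →ₗ[Aᵐᵒᵖ] X') {Y Z : AlgBimodule k A B}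
    (hYZ : Y.NIsomorphic δ n Z)
    (hY : δ Bᵐᵒᵖ (LinearMap.ker (NCTensor.rTensor (R := A) Bᵐᵒᵖ Y π)) ≤ ((n : ℝ) : EReal)) :
    δ Bᵐᵒᵖ (LinearMap.ker (NCTensor.rTensor (R := A) Bᵐᵒᵖ Z π)) ≤ ((n : ℝ) : EReal) := by
  obtain ⟨P, f, g, hf, hg⟩ := hYZ
  let f' (X : Type u) [AddCommGroup X] [Module Aᵐᵒᵖ X] :=
    NCTensor.lTensor (R := A) (Q := Bᵐᵒᵖ) X f.toLeftLinearMap fun b y => f.toLinearMap.map_smul b y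
  let g' (X : Type u) [AddCommGroup X] [Module Aᵐᵒᵖ X] :=
    NCTensor.lTensor (R := A) (Q := Bᵐᵒᵖ) X g.toLeftLinearMap fun b z => g.toLinearMap.map_smul b z
  have hP : δ Bᵐᵒᵖ (LinearMap.ker (NCTensor.rTensor (R := A) Bᵐᵒᵖ P π)) ≤ ((n : ℝ) : EReal) :=
    hB.ker_le_of_square (f' X) (f' X')
      (NCTensor.lTensor_rTensor π f.toLeftLinearMap fun b y => f.toLinearMap.map_smul b y)
      (NCTensor.dim_coker_lTensor_le X hB f.toLeftLinearMap f.toLinearMap (fun _ => rfl) hf.2)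
      (NCTensor.dim_ker_lTensor_le hB f.toLeftLinearMap f.toLinearMap (fun _ => rfl) hf.1 hf.2) hY
  exact hB.ker_le_of_square' (g' X) (g' X')
    (NCTensor.lTensor_rTensor π g.toLeftLinearMap fun b z => g.toLinearMap.map_smul b z)
    (NCTensor.dim_ker_lTensor_le hB g.toLeftLinearMap g.toLinearMap (fun _ => rfl) hg.1 hg.2) hP

theorem dim_ker_le_of_dim_ker_rTensor_le (hB : δ.IsExact Bᵐᵒᵖ) [IsNoetherianRing Bᵐᵒᵖ]
    {T : AlgBimodule k A B} {T' : AlgBimodule k B A}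
    (hT'T : (T'.tensor T).NIsomorphic δ n (AlgBimodule.regular k B))
    {X Y : Type u} [AddCommGroup X] [Module Bᵐᵒᵖ X] [AddCommGroup Y] [Module Bᵐᵒᵖ Y]
    [Module.Finite Bᵐᵒᵖ X] [Module.Finite Bᵐᵒᵖ Y] (π : X →ₗ[Bᵐᵒᵖ] Y)
    (hπ : δ Bᵐᵒᵖ (LinearMap.ker (NCTensor.rTensor (R := A) Bᵐᵒᵖ T
      (NCTensor.rTensor (R := B) Aᵐᵒᵖ T' π))) ≤ ((n : ℝ) : EReal)) :
    δ Bᵐᵒᵖ (LinearMap.ker π) ≤ ((n : ℝ) : EReal) := by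
  have hassoc : δ Bᵐᵒᵖ (LinearMap.ker (NCTensor.rTensor (R := B) Bᵐᵒᵖ (T'.tensor T) π)) ≤
      ((n : ℝ) : EReal) :=
    hB.ker_le_of_square (NCTensor.assoc B A Bᵐᵒᵖ X T' T).toLinearMap
      (NCTensor.assoc B A Bᵐᵒᵖ Y T' T).toLinearMap
      (fun t => (NCTensor.assoc_rTensor_rTensor π t).symm)
      (hB.coker_le_of_surjective _ (NCTensor.assoc B A Bᵐᵒᵖ X T' T).surjective)
      (hB.ker_le_of_injective _ (NCTensor.assoc B A Bᵐᵒᵖ Y T' T).injective) hπ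
  exact hB.ker_le_of_square' (f' := NCTensor.rTensor (R := B) Bᵐᵒᵖ B π)
    (NCTensor.unit B X).toLinearMap (NCTensor.unit B Y).toLinearMap
    (fun _ => rfl) (hB.ker_le_of_injective _ (NCTensor.unit B X).injective)
    (hT'T.dim_ker_rTensor_le hB π hassoc)

end AlgBimodule

/-! ### Reflexive hulls of invertible bimodules -/

namespace DimFunction

section Dualizing

variable {δ : DimFunction.{u}} {d : ℕ} {A : Type u} [Ring A] [IsNoetherianRing A]
  [IsNoetherianRing Aᵐᵒᵖ]

/-- The ring `A` as a free right module over itself. -/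
def opSelfEquiv (A : Type u) [Ring A] : Aᵐᵒᵖ ≃ₗ[Aᵐᵒᵖ] A where
  toFun := MulOpposite.unop
  invFun := MulOpposite.op
  map_add' _ _ := rfl
  map_smul' _ _ := rfl

theorem isDualizing_left (h : δ.IsExact A) (hAG : IsAuslanderGorenstein A)
    (hCM : IsCohenMacaulayOfDim δ A d) : δ.IsDualizing d A Aᵐᵒᵖ A where
  exact := h
  noeth_left := inferInstance
  noeth_right := inferInstance
  finite_left := inferInstance
  finite_right := Module.Finite.equiv (opSelfEquiv A)
  free_right := Module.Free.of_equiv (opSelfEquiv A)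
  bijective_toModuleEnd := by
    refine ⟨fun a b hab => by simpa using LinearMap.congr_fun hab (1 : A), fun f => ⟨f 1, ?_⟩⟩
    exact LinearMap.ext fun x =>
      (map_smul f (MulOpposite.op x) 1).symm.trans (congrArg f (one_mul x))
  grade_add_dim M _ _ := hCM.2.1 M
  auslander M _ _ := hAG.2.2 M

theorem isDualizing_right (h : δ.IsExact Aᵐᵒᵖ) (hAG : IsAuslanderGorenstein A)
    (hCM : IsCohenMacaulayOfDim δ A d) : δ.IsDualizing d Aᵐᵒᵖ A A where
  exact := h
  noeth_left := inferInstance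
  noeth_right := inferInstance
  finite_left := Module.Finite.equiv (opSelfEquiv A)
  finite_right := inferInstance
  free_right := inferInstance
  bijective_toModuleEnd := by
    refine ⟨fun a b hab => by simpa using LinearMap.congr_fun hab (1 : A),
      fun f => ⟨MulOpposite.op (f 1), ?_⟩⟩
    exact LinearMap.ext fun x => (map_smul f x 1).symm.trans (congrArg f (mul_one x))
  grade_add_dim M _ _ := hCM.2.2 M
  auslander M _ _ := hAG.2.1 M

end Dualizing

variable {δ : DimFunction.{u}} {k : Type v} [CommRing k] {A B : Type u} [Ring A] [Algebra k A]
  [Ring B] [Algebra k B]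

theorem IsSymmetric.isSymmetricPair (h : δ.IsSymmetric k A B) :
    δ.IsSymmetricPair (fun c : k => MulOpposite.op (algebraMap k B c)) (algebraMap k A) := by
  intro M _ _ _ _ hM
  exact h { carrier := M, central := fun c m => (hM c m).symm }

theorem SatisfiesGamma.rightGamma {n : ℤ} (h : δ.SatisfiesGamma k A B n 1) {M : AlgBimodule k A B}
    (hM : M.IsFG) : δ.RightGamma n M := (h M hM).1

end DimFunction

namespace AlgBimodule

open DimFunction

attribute [local instance] NCTensor.leftAction NCTensor.rightAction

variable {δ : DimFunction.{u}} {d : ℕ} {k : Type v} [CommRing k] {A B : Type u} [Ring A]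
  [Algebra k A] [Ring B] [Algebra k B]

theorem dim_torsion_le_of_nIsomorphic (hAl : δ.IsDualizing d A Aᵐᵒᵖ A)
    (hAr : δ.IsDualizing d Aᵐᵒᵖ A A) (hB : δ.IsExact Bᵐᵒᵖ) [IsNoetherianRing Bᵐᵒᵖ]
    (hs : δ.IsSymmetric k A B) {T : AlgBimodule k A B} {T' : AlgBimodule k B A}
    (hγ : δ.RightGamma ((d : ℤ) - 2) T) (hT : T.IsFG) (hT' : T'.IsFG)
    (hTT' : (T.tensor T').NIsomorphic δ ((d : ℤ) - 2) (AlgBimodule.regular k A))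
    (hT'T : (T'.tensor T).NIsomorphic δ ((d : ℤ) - 2) (AlgBimodule.regular k B)) :
    δ Bᵐᵒᵖ (torsion δ (codim d 1) Bᵐᵒᵖ T) ≤ codim d 2 := by
  have := hT.2
  have := hT'.1
  have := hT'.2
  have := hAl.noeth_right
  have : Module.Finite Aᵐᵒᵖ (NCTensor B T T') := NCTensor.finite_right
  have hker := hTT'.dim_ker_rTensor_mkQ_torsion_le ((codim_strictAnti d).antitone one_le_two)
    hAl.exact hAr.exact hB hs hAl.isTorsionFree_self hAr.isTorsionFree_self
  have hker' := hγ.dim_ker_le_of_surjective hB _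
    (NCTensor.map_surjective (Submodule.mkQ_surjective _) Function.surjective_id) hker
  have hmkQ := dim_ker_le_of_dim_ker_rTensor_le hB hT'T _ hker'
  rwa [Submodule.ker_mkQ] at hmkQ

theorem exists_hom_isReflexiveOnBothSides (hA : δ.IsDualizing d A Aᵐᵒᵖ A)
    (hB : δ.IsDualizing d Bᵐᵒᵖ B B) (hs : δ.IsSymmetric k A B) {T : AlgBimodule k A B}
    (hT : T.IsFG) (htors : δ Bᵐᵒᵖ (torsion δ (codim d 1) Bᵐᵒᵖ T) ≤ codim d 2) :
    ∃ (U : AlgBimodule k A B) (f : Hom T U),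
      U.IsFG ∧ U.IsReflexiveOnBothSides ∧ f.IsNIso δ ((d : ℤ) - 2) := by
  have := hT.1
  have := hT.2
  let N := torsion δ (codim d 1) Bᵐᵒᵖ T
  let T₀ := T.quotient N (smul_mem_torsion hB.exact)
  let π : Hom T T₀ := T.quotientHom N _
  have hπ : Function.Surjective π.toLinearMap := N.mkQ_surjective
  have : Module.Finite A T₀ := Module.Finite.of_surjective π.toLeftLinearMap hπ
  have : Module.Finite Bᵐᵒᵖ T₀ := Module.Finite.of_surjective π.toLinearMap hπ
  have htf : IsTorsionFree δ (codim d 1) Bᵐᵒᵖ T₀ := hB.exact.isTorsionFree_quotient_torsion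
  have hk (c : k) (x : T₀) := (T₀.central c x).symm
  have hcA (c : k) (x : A) : algebraMap k A c • x = MulOpposite.op (algebraMap k A c) • x :=
    Algebra.commutes c x
  have hcB (c : k) (x : B) : MulOpposite.op (algebraMap k B c) • x = algebraMap k B c • x :=
    (Algebra.commutes c x).symm
  let U : AlgBimodule k A B :=
    { carrier := DoubleDual Bᵐᵒᵖ B B T₀
      central := fun c F => (IsDualizing.central_doubleDual hcB hk c F).symm }
  let ev : Hom T₀ U :=
    { toLinearMap := DoubleDual.eval Bᵐᵒᵖ B B T₀, map_left_smul := fun _ _ => rfl }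
  have hev : ev.IsNIso δ ((d : ℤ) - 2) :=
    ⟨hB.exact.ker_le_of_injective _ (hB.eval_injective htf), hB.dim_coker_eval_le⟩
  have hπ' : π.IsNIso δ ((d : ℤ) - 2) :=
    ⟨(congrArg (fun W : Submodule Bᵐᵒᵖ T => δ Bᵐᵒᵖ W) N.ker_mkQ).trans_le htors,
      hB.exact.coker_le_of_surjective _ hπ⟩
  have hright := hB.isReflexiveModule_doubleDual (M := T₀)
  have hleft := hB.isReflexiveModule_otherSide hA hs.isSymmetricPair hcB hcA hk htf
  exact ⟨U, ev.comp π, ⟨hleft.1, hright.1⟩, ⟨hleft, hright⟩, hev.comp hB.exact hπ'⟩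

end AlgBimodule

theorem proposition3p9_general {k : Type v} [CommRing k] {B₁ B₂ : Type u} [Ring B₁] [Algebra k B₁]
    [Ring B₂] [Algebra k B₂] (δ : DimFunction.{u}) (d : ℕ)
    (h₁l : δ.IsDualizing d B₁ B₁ᵐᵒᵖ B₁) (h₁r : δ.IsDualizing d B₁ᵐᵒᵖ B₁ B₁)
    (h₂l : δ.IsDualizing d B₂ B₂ᵐᵒᵖ B₂) (h₂r : δ.IsDualizing d B₂ᵐᵒᵖ B₂ B₂)
    (hsymm₁₂ : δ.IsSymmetric k B₁ B₂) (hsymm₂₁ : δ.IsSymmetric k B₂ B₁)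
    (T : AlgBimodule k B₁ B₂) (T' : AlgBimodule k B₂ B₁) (hT : T.IsFG) (hT' : T'.IsFG)
    (hγ : δ.RightGamma ((d : ℤ) - 2) T) (hγ' : δ.RightGamma ((d : ℤ) - 2) T')
    (hTT' : (T.tensor T').NIsomorphic δ ((d : ℤ) - 2) (AlgBimodule.regular k B₁))
    (hT'T : (T'.tensor T).NIsomorphic δ ((d : ℤ) - 2) (AlgBimodule.regular k B₂)) :
    ∃ (U : AlgBimodule k B₁ B₂) (V : AlgBimodule k B₂ B₁),
      U.IsFG ∧ V.IsFG ∧ U.IsReflexiveOnBothSides ∧ V.IsReflexiveOnBothSides ∧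
      (U.tensor V).NIsomorphic δ ((d : ℤ) - 2) (AlgBimodule.regular k B₁) ∧
      (V.tensor U).NIsomorphic δ ((d : ℤ) - 2) (AlgBimodule.regular k B₂) := by
  have := h₁l.noeth_right
  have := h₂l.noeth_right
  obtain ⟨U, f, hU, hUr, hf⟩ := AlgBimodule.exists_hom_isReflexiveOnBothSides h₁l h₂r hsymm₁₂ hT
    (AlgBimodule.dim_torsion_le_of_nIsomorphic h₁l h₁r h₂r.exact hsymm₁₂ hγ hT hT' hTT' hT'T)
  obtain ⟨V, g, hV, hVr, hg⟩ := AlgBimodule.exists_hom_isReflexiveOnBothSides h₂l h₁r hsymm₂₁ hT'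
    (AlgBimodule.dim_torsion_le_of_nIsomorphic h₂l h₂r h₁r.exact hsymm₂₁ hγ' hT' hT hT'T hTT')
  have := hT.2
  have := hT'.2
  have := hU.2
  have := hV.2
  exact ⟨U, V, hU, hV, hUr, hVr, .of_isNIso h₁r.exact (hf.tensor h₁r.exact hg hγ') hTT',
    .of_isNIso h₂r.exact (hg.tensor h₂r.exact hf hγ) hT'T⟩

theorem proposition3p9 {k : Type v} [CommRing k]
    {B₁ B₂ : Type u} [Ring B₁] [Algebra k B₁] [Ring B₂] [Algebra k B₂]
    [IsNoetherianRing B₁] [IsNoetherianRing B₁ᵐᵒᵖ]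
    [IsNoetherianRing B₂] [IsNoetherianRing B₂ᵐᵒᵖ]
    (δ : DimFunction.{u}) (d : ℕ)
    (hex₁l : δ.IsExact B₁) (hex₁r : δ.IsExact B₁ᵐᵒᵖ)
    (hex₂l : δ.IsExact B₂) (hex₂r : δ.IsExact B₂ᵐᵒᵖ)
    (hsymm₁₂ : δ.IsSymmetric k B₁ B₂) (hsymm₂₁ : δ.IsSymmetric k B₂ B₁)
    (hγ₁₂ : δ.SatisfiesGamma k B₁ B₂ ((d : ℤ) - 2) 1)
    (hγ₂₁ : δ.SatisfiesGamma k B₂ B₁ ((d : ℤ) - 2) 1)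
    (hAG₁ : IsAuslanderGorenstein B₁) (hAG₂ : IsAuslanderGorenstein B₂)
    (hCM₁ : IsCohenMacaulayOfDim δ B₁ d) (hCM₂ : IsCohenMacaulayOfDim δ B₂ d)
    (T : AlgBimodule k B₁ B₂) (T' : AlgBimodule k B₂ B₁) (hT : T.IsFG) (hT' : T'.IsFG)
    (hTT' : (T.tensor T').NIsomorphic δ ((d : ℤ) - 2) (AlgBimodule.regular k B₁))
    (hT'T : (T'.tensor T).NIsomorphic δ ((d : ℤ) - 2) (AlgBimodule.regular k B₂)) :
    ∃ (U : AlgBimodule k B₁ B₂) (V : AlgBimodule k B₂ B₁),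
      U.IsFG ∧ V.IsFG ∧ U.IsReflexiveOnBothSides ∧ V.IsReflexiveOnBothSides ∧
      (U.tensor V).NIsomorphic δ ((d : ℤ) - 2) (AlgBimodule.regular k B₁) ∧
      (V.tensor U).NIsomorphic δ ((d : ℤ) - 2) (AlgBimodule.regular k B₂) := by
  exact proposition3p9_general δ d (DimFunction.isDualizing_left hex₁l hAG₁ hCM₁)
    (DimFunction.isDualizing_right hex₁r hAG₁ hCM₁) (DimFunction.isDualizing_left hex₂l hAG₂ hCM₂)
    (DimFunction.isDualizing_right hex₂r hAG₂ hCM₂) hsymm₁₂ hsymm₂₁ T T' hT hT'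
    (hγ₁₂.rightGamma hT) (hγ₂₁.rightGamma hT') hTT' hT'T
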